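/- Let $S,L,R,Q$ be constant complex matrices of sizes $M\times N$, $M\times M$, $N\times N$, $N\times M$, let $H=\begin{pmatrix} R&Q\\ S&L\end{pmatrix}$, and write $H^n=\begin{pmatrix} R_n&Q_n\\ S_n&L_n\end{pmatrix}$ for $n\ge 1$. Let $\mathbf t=(t_1,t_2,\dots)$ be real variables. All functions are defined on sets $U$ of sequences $\mathbf t$ that are open in any finite number of the variables, and solutions are smooth in any finite number of the variables. For a function $\phi$ let $\phi_{[\lambda]}(\mathbf t)=\phi(t_1+\lambda,t_2+\lambda^2/2,t_3+\lambda^3/3,\dots)$, understood as the formal Taylor series $\exp\big(\sum_{j\ge1}\frac{\lambda^j}{j}\partial_{t_j}\big)\phi$ in the indeterminate $\lambda$. The pKP hierarchy in an algebra with product $\circ$ is the system $$\sum_{i,j,k=1}^3\varepsilon_{ijk}\Big(\lambda_i^{-1}(\phi_{[\lambda_i]}-\phi)+\phi\circ\phi_{[\lambda_i]}\Big)_{[\lambda_k]}=0$$ (an identity of formal power series in the indeterminates $\lambda_1,\lambda_2,\lambda_3$); the scalar pKP hierarchy is the case of $\mathbb C$ with the ordinary product. The matrix Riccati hierarchy is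 $$\phi_{t_n}=S_n+L_n\phi-\phi R_n-\phi Q_n\phi,\qquad n=1,2,\dots,$$ for $M\times N$ matrix functions $\phi$. Let $\xi(A)=\sum_{n\ge1}t_nA^n$. Then: 1. If $Z=\begin{pmatrix} X\\ Y\end{pmatrix}$ ($X$ of size $N\times N$, $Y$ of size $M\times N$) solves $Z_{t_n}=H^nZ$ for all $n\ge1$ on $U$ and $X$ is invertible on $U$, then $\phi=YX^{-1}$ solves the matrix Riccati hierarchy on $U$. For any constant $Z_0$, $Z=e^{\xi(H)}Z_0$ solves this linear system on the set of all $\mathbf t$ for which $\xi(H)$ converges (absolutely), and so $\phi=YX^{-1}$ solves the matrix Riccati hierarchy where moreover $X$ is invertible. 2. Any solution $\phi$ of the matrix Riccati hierarchy on $U$ solves on $U$ the pKP hierarchy in the $M\times N$ matrices with the product $A\circ B=AQB$. 3. If $\operatorname{rank}Q=1$, then $\phi\mapsto\operatorname{tr}(Q\phi)$ is a homomorphism (it is linear, maps smooth functions to smooth functions, and satisfies $\operatorname{tr}(Q(A\circ B))=\operatorname{tr}(QA)\operatorname{tr}(QB)$), and if $\phi$ solves the pKP hierarchy in the matrices with $A\circ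 B=AQB$ on $U$, then $\operatorname{tr}(Q\phi)$ solves the scalar pKP hierarchy on $U$. 4. Suppose $S=0$ and $Q=RK-KL$ with an $N\times M$ matrix $K$. Let $Z_0=\begin{pmatrix} X_0\\ Y_0\end{pmatrix}$ with $X_0$ invertible, $\phi_0=Y_0X_0^{-1}$, let $\phi=YX^{-1}$ with $\begin{pmatrix} X\\ Y\end{pmatrix}=e^{\xi(H)}Z_0$, and $$T:=I_N+K\phi_0-e^{-\xi(R)}Ke^{\xi(L)}\phi_0,\qquad \tau:=\det T .$$ The set of $\mathbf t$ where $\xi(H)$ converges and $X$ is invertible is the set where $\xi(R)$ and $\xi(L)$ converge and $\tau\ne0$; it contains $\mathbf t=0$. On it, $\phi=e^{\xi(L)}\phi_0T^{-1}e^{-\xi(R)}$ solves the pKP hierarchy with the product $A\circ B=AQB$, and $$\operatorname{tr}(Q\phi)=(\log\tau)_{t_1}$$ (for a local branch of the logarithm, i.e. $\operatorname{tr}(Q\phi)=\tau_{t_1}/\tau$). If moreover $\operatorname{rank}Q=1$, then $\operatorname{tr}(Q\phi)$ solves the scalar pKP hierarchy there. -/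

import Mathlib

open scoped Topology ContDiff

namespace RiccatiKP

/-- The independent real variables `t₁, t₂, t₃, …`, indexed by the positive integers. -/
abbrev Times : Type := ℕ+ → ℝ

/-- The point `(s₀, s₁, …, s_{N-1}, 0, 0, …)`, i.e. `t_{i+1} = s i` for `i < N`, `t_k = 0` for
`k > N`. -/
def incl {N : ℕ} (s : Fin N → ℝ) : Times :=
  ∑ i : Fin N, Pi.single (Nat.succPNat (i : ℕ)) (s i)

/-- `U` is open in every finite number of the variables: if `t ∈ U`, then every sufficiently small
change of `t₁, …, t_N` (the other variables being fixed) stays in `U`. -/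
def IsFinOpen (U : Set Times) : Prop :=
  ∀ t ∈ U, ∀ N : ℕ, ∀ᶠ s in 𝓝 (0 : Fin N → ℝ), t + incl s ∈ U

section Functions

variable {V : Type*} [AddCommGroup V] [Module ℝ V] [TopologicalSpace V]

/-- The partial derivative `∂_{t_k} f`. -/
noncomputable def pd (k : ℕ+) (f : Times → V) (t : Times) : V :=
  deriv (fun s : ℝ => f (t + Pi.single k s)) 0

/-- Smoothness on `U` of a function with values in a finite-dimensional space `V` (only such `V`
are used): the real and imaginary parts of all components, i.e. all compositions with real linear
functionals of `V`, are smooth in any finite number of the variables. -/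
def SmoothOn (U : Set Times) (f : Times → V) : Prop :=
  ∀ t ∈ U, ∀ N : ℕ, ∀ l : V →L[ℝ] ℝ,
    ContDiffAt ℝ ∞ (fun s : Fin N → ℝ => l (f (t + incl s))) 0

/-- `shiftCoeff f k` is the coefficient of `lam ^ k` in the formal Taylor expansion
`f (t + [lam]) = exp (∑_{j ≥ 1} (lam ^ j / j) ∂_{t_j}) f`, where
`[lam] = (lam, lam² / 2, lam³ / 3, …)`.
Differentiating the exponential with respect to `lam` gives the recursion
`(k + 1) c_{k+1} = ∑_{j=0}^{k} ∂_{t_{j+1}} c_{k-j}`, `c_0 = f`.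
For example `c_1 = ∂_{t_1} f` and `c_2 = (∂_{t_1}² f + ∂_{t_2} f) / 2`. -/
noncomputable def shiftCoeff (f : Times → V) : ℕ → Times → V
  | 0 => f
  | k + 1 => fun t =>
      ((k : ℝ) + 1)⁻¹ • ∑ j : Fin (k + 1), pd (Nat.succPNat (j : ℕ)) (shiftCoeff f (k - j)) t

/-- Formal power series in the three indeterminates `lam_0, lam_1, lam_2` with coefficients in the
`V`-valued functions of `t`: `F d` is the coefficient of `∏ i, lam_i ^ (d i)`. -/
abbrev FormalSeries (V : Type*) : Type _ := (Fin 3 →₀ ℕ) → Times → V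

/-- A function, as a constant formal series. -/
def FormalSeries.const (f : Times → V) : FormalSeries V :=
  fun d => if d = 0 then f else 0

/-- The shift `F ↦ F_{[lam_i]}`, applied to all coefficients of the formal series `F`. -/
noncomputable def FormalSeries.shift (i : Fin 3) (F : FormalSeries V) : FormalSeries V :=
  fun d => ∑ k ∈ Finset.range (d i + 1), shiftCoeff (F (d - Finsupp.single i k)) k

/-- `lam_i⁻¹ F`, for a formal series `F` without terms of degree `0` in `lam_i`. -/
noncomputable def FormalSeries.divX (i : Fin 3) (F : FormalSeries V) : FormalSeries V :=
  fun d => F (d + Finsupp.single i 1)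

/-- The product `f ∘ F` of a function with a formal series, for the product `mul` in `V`. -/
def FormalSeries.lmul (mul : V → V → V) (f : Times → V) (F : FormalSeries V) : FormalSeries V :=
  fun d t => mul (f t) (F d t)

/-- The formal series `lam_i⁻¹ (φ_{[lam_i]} - φ) + φ ∘ φ_{[lam_i]}`. -/
noncomputable def pkpTerm (mul : V → V → V) (φ : Times → V) (i : Fin 3) : FormalSeries V :=
  FormalSeries.divX i (FormalSeries.shift i (FormalSeries.const φ) - FormalSeries.const φ)
    + FormalSeries.lmul mul φ (FormalSeries.shift i (FormalSeries.const φ))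

/-- The left-hand side of the potential KP hierarchy
`∑_{i,j,k} ε_{ijk} (lam_i⁻¹ (φ_{[lam_i]} - φ) + φ ∘ φ_{[lam_i]})_{[lam_k]} = 0`.
As `ε_{ijk}` vanishes unless `(i, j, k)` is a permutation, and is then its sign, the sum is over
the permutations `σ`, with `(i, j, k) = (σ 0, σ 1, σ 2)`. -/
noncomputable def pkpSeries (mul : V → V → V) (φ : Times → V) : FormalSeries V :=
  ∑ σ : Equiv.Perm (Fin 3),
    (Equiv.Perm.sign σ : ℤ) • FormalSeries.shift (σ 2) (pkpTerm mul φ (σ 0))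

/-- `φ` is a smooth solution, on the domain `U`, of the potential KP hierarchy in the algebra
`(V, mul)`: all coefficients of the formal series above vanish on `U`. -/
def IsPKPSolution (mul : V → V → V) (U : Set Times) (φ : Times → V) : Prop :=
  IsFinOpen U ∧ SmoothOn U φ ∧ ∀ d : Fin 3 →₀ ℕ, ∀ t ∈ U, pkpSeries mul φ d t = 0

end Functions

section Matrices

open Matrix

variable {m n p : Type*} [Fintype m] [DecidableEq m] [Fintype n] [DecidableEq n]
  [Fintype p] [DecidableEq p]

/-- The product `A ∘ B = A Q B` of `m × n` matrices. -/
def qMul (Q : Matrix n m ℂ) (A B : Matrix m n ℂ) : Matrix m n ℂ := A * Q * B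

/-- `φ` is a smooth solution on `U` of the matrix Riccati hierarchy
`φ_{t_k} = S_k + L_k φ - φ R_k - φ Q_k φ`, `k = 1, 2, …`, where `H ^ k` has the blocks
`R_k, Q_k` (first block row) and `S_k, L_k` (second block row). -/
def IsRiccatiSolution (H : Matrix (n ⊕ m) (n ⊕ m) ℂ) (U : Set Times)
    (φ : Times → Matrix m n ℂ) : Prop :=
  IsFinOpen U ∧ SmoothOn U φ ∧ ∀ k : ℕ+, ∀ t ∈ U,
    pd k φ t = (H ^ (k : ℕ)).toBlocks₂₁ + (H ^ (k : ℕ)).toBlocks₂₂ * φ t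
      - φ t * (H ^ (k : ℕ)).toBlocks₁₁ - φ t * (H ^ (k : ℕ)).toBlocks₁₂ * φ t

/-- `Z` is a smooth solution on `U` of the linear system `Z_{t_k} = H ^ k Z`, `k = 1, 2, …`. -/
def IsLinearSolution (H : Matrix (n ⊕ m) (n ⊕ m) ℂ) (U : Set Times)
    (Z : Times → Matrix (n ⊕ m) n ℂ) : Prop :=
  IsFinOpen U ∧ SmoothOn U Z ∧ ∀ k : ℕ+, ∀ t ∈ U, pd k Z t = H ^ (k : ℕ) * Z t

/-- The function `Y X⁻¹`, where `X` and `Y` are the upper and lower blocks of `Z`. -/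
noncomputable def ratio (Z : Times → Matrix (n ⊕ m) n ℂ) : Times → Matrix m n ℂ :=
  fun t => (Z t).toRows₂ * ((Z t).toRows₁)⁻¹

/-- The set of all `t` for which the series `ξ(A) = ∑_{k ≥ 1} t_k A ^ k` converges. -/
def xiDomain (A : Matrix p p ℂ) : Set Times :=
  {t | Summable fun k : ℕ+ => t k • A ^ (k : ℕ)}

/-- `ξ(A) = ∑_{k ≥ 1} t_k A ^ k`. -/
noncomputable def xi (A : Matrix p p ℂ) (t : Times) : Matrix p p ℂ :=
  ∑' k : ℕ+, t k • A ^ (k : ℕ)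

/-- `Z(t) = e^{ξ(H)} Z₀`. -/
noncomputable def expSolution (H : Matrix (n ⊕ m) (n ⊕ m) ℂ) (Z₀ : Matrix (n ⊕ m) n ℂ)
    (t : Times) : Matrix (n ⊕ m) n ℂ :=
  NormedSpace.exp (xi H t) * Z₀

/-- The set of all `t` for which `ξ(H)` converges and the upper block `X` of `e^{ξ(H)} Z₀` is
invertible. -/
def regularDomain (H : Matrix (n ⊕ m) (n ⊕ m) ℂ) (Z₀ : Matrix (n ⊕ m) n ℂ) : Set Times :=
  {t | t ∈ xiDomain H ∧ IsUnit (expSolution H Z₀ t).toRows₁}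

/-- The matrix `I + K φ₀ - e^{-ξ(R)} K e^{ξ(L)} φ₀`. -/
noncomputable def tauMatrix (R : Matrix n n ℂ) (L : Matrix m m ℂ) (K : Matrix n m ℂ)
    (φ₀ : Matrix m n ℂ) (t : Times) : Matrix n n ℂ :=
  1 + K * φ₀ - NormedSpace.exp (-xi R t) * K * NormedSpace.exp (xi L t) * φ₀

/-- `(log τ)_{t_k} = v` at the point `t`: near `t` and along the `t_k`-axis, `τ` is nowhere zero
and has a logarithm (a branch of `log τ`) which is differentiable at `t` with derivative `v`.
Equivalently, `τ t ≠ 0`, `τ` has a partial derivative at `t`, and `τ_{t_k} / τ = v` there. -/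
def HasLogPartialDeriv (k : ℕ+) (τ : Times → ℂ) (v : ℂ) (t : Times) : Prop :=
  ∃ l : ℝ → ℂ, (∀ᶠ s in 𝓝 (0 : ℝ), Complex.exp (l s) = τ (t + Pi.single k s)) ∧
    HasDerivAt l v 0

end Matrices

end RiccatiKP

open RiccatiKP

namespace RiccatiKP

/-! ### Finite perturbations of an infinite vector of times. -/

section Incl

/-! The core is a closed formula for the formal shift of a Riccati solution. Write `ρ_k` for the
right-hand side of the `k`-th equation. Then the coefficients of `φ_{[lam]}` are `φ` and, for `k ≥
0`, `(L - φ Q)^k ρ_1` at `lam^(k+1)` (`shiftCoeff_riccati`). Equivalently, `lam⁻¹ (φ_{[lam]} - φ) +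
φ Q φ_{[lam]} = (S - φ R) + L φ_{[lam]}`. After the second shift and antisymmetrization both terms
on the right disappear: the first involves only the index `k` of the second shift, hence is
symmetric in `i, j`; the second is symmetric in `i, k` because shifts commute
(`isPKPSolution_of_shiftCoeff`). The formula itself is an induction (`sum_pd_riccatiCoeff`) resting
on two recursions for blocks of `H^k` (`riccatiRHS_succ`, `riccati_block_eq_sum`).

The Riccati equations for `Y X⁻¹` come from differentiating `φ X = Y`. For `e^{ξ(H)} Z₀`, a change
of finitely many times alters `ξ(H)` by a finite sum of commuting terms, so the exponential factors
and ordinary calculus applies. If `Q` has rank one, `Q = u vᵀ`, then `tr (Q A) = vᵀ A u`, which is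
multiplicative for `A Q B`; algebra homomorphisms preserve pKP (`IsPKPSolution.map`).

For `S = 0`, `Q = R K - K L`, the rows `(0 1)` and `(1 K)` intertwine `H` with `L` and with `R`.
Hence `Y` and `X + K Y` evolve separately, by `e^{ξ(L)}` and `e^{ξ(R)}`, which gives `X = e^{ξ(R)} T
X₀`. The trace formula is then Jacobi's formula for `det T`, since `T_{t_1} = e^{-ξ(R)} Q e^{ξ(L)}
φ₀`. -/

theorem incl_apply {N : ℕ} (s : Fin N → ℝ) (k : ℕ+) :
    incl s k = if h : k.natPred < N then s ⟨k.natPred, h⟩ else 0 := by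
  have key : ∀ i : Fin N, (Pi.single (Nat.succPNat (i : ℕ)) (s i) : Times) k
      = if (i : ℕ) = k.natPred then s i else 0 := by
    intro i
    rw [Pi.single_apply]
    refine if_congr ⟨?_, ?_⟩ rfl rfl
    · rintro rfl; simp
    · intro h; rw [h]; simp
  rw [incl, Finset.sum_apply, Finset.sum_congr rfl fun i _ => key i]
  split_ifs with h
  · rw [Finset.sum_eq_single ⟨k.natPred, h⟩]
    · simp
    · intro b _ hb
      rw [if_neg]
      intro h'
      exact hb (Fin.ext h')
    · simp
  · refine Finset.sum_eq_zero fun i _ => if_neg ?_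
    intro h'
    exact h (h' ▸ i.2)

theorem incl_add {N : ℕ} (s r : Fin N → ℝ) : incl (s + r) = incl s + incl r := by
  funext k
  simp only [incl_apply, Pi.add_apply]
  split_ifs <;> simp

@[simp] theorem incl_zero {N : ℕ} : incl (0 : Fin N → ℝ) = 0 := by
  funext k
  simp [incl_apply]

theorem incl_single {N : ℕ} (i : Fin N) (r : ℝ) :
    incl (Pi.single i r) = Pi.single (Nat.succPNat (i : ℕ)) r := by
  rw [incl, Finset.sum_eq_single i]
  · simp
  · intro b _ hb
    simp [Pi.single_eq_of_ne hb]
  · simp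

/-- Extension of a finite tuple by zeros. -/
noncomputable def extendZero (N N' : ℕ) : (Fin N → ℝ) →L[ℝ] (Fin N' → ℝ) :=
  ContinuousLinearMap.pi fun i =>
    if h : (i : ℕ) < N then ContinuousLinearMap.proj (⟨i, h⟩ : Fin N) else 0

theorem incl_extendZero {N N' : ℕ} (h : N ≤ N') (s : Fin N → ℝ) :
    incl (extendZero N N' s) = incl s := by
  funext k
  simp only [incl_apply, extendZero, ContinuousLinearMap.coe_pi']
  by_cases h1 : k.natPred < N
  · simp [h1, h1.trans_le h]
  · simp [h1]

theorem IsFinOpen.eventually_single {U : Set Times} (hU : IsFinOpen U) {t : Times} (ht : t ∈ U)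
    (k : ℕ+) : ∀ᶠ r in 𝓝 (0 : ℝ), t + Pi.single k r ∈ U := by
  have hcont : Filter.Tendsto
      (fun r : ℝ => (Pi.single (Fin.last k.natPred) r : Fin (k.natPred + 1) → ℝ))
      (𝓝 0) (𝓝 0) := by
    have : Continuous (fun r : ℝ =>
        (Pi.single (Fin.last k.natPred) r : Fin (k.natPred + 1) → ℝ)) := continuous_single (A := fun _ => ℝ) _
    simpa using this.tendsto 0
  filter_upwards [hcont.eventually (hU t ht (k.natPred + 1))] with r hr
  rw [incl_single] at hr
  simpa using hr

end Incl

/-! ### Smoothness and partial derivatives in finitely many variables. -/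

section General

variable {V : Type*} [AddCommGroup V] [Module ℝ V] [TopologicalSpace V]
variable {W : Type*} [AddCommGroup W] [Module ℝ W] [TopologicalSpace W]

theorem SmoothOn.mono {U U' : Set Times} {f : Times → V} (hf : SmoothOn U f) (h : U' ⊆ U) :
    SmoothOn U' f := fun t ht => hf t (h ht)

theorem smoothOn_const (U : Set Times) (v : V) : SmoothOn U (fun _ => v) :=
  fun _ _ _ _ => contDiffAt_const

theorem SmoothOn.add {U : Set Times} {f g : Times → V} (hf : SmoothOn U f) (hg : SmoothOn U g) :
    SmoothOn U (f + g) := by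
  intro t ht N l
  simpa using (hf t ht N l).add (hg t ht N l)

theorem SmoothOn.sub {U : Set Times} {f g : Times → V} (hf : SmoothOn U f) (hg : SmoothOn U g) :
    SmoothOn U (f - g) := by
  intro t ht N l
  simpa using (hf t ht N l).sub (hg t ht N l)

theorem SmoothOn.sum {U : Set Times} {ι : Type*} {s : Finset ι} {f : ι → Times → V}
    (hf : ∀ i ∈ s, SmoothOn U (f i)) : SmoothOn U (∑ i ∈ s, f i) := by
  intro t ht N l
  simpa using ContDiffAt.sum fun i hi => hf i hi t ht N l

theorem SmoothOn.clm {U : Set Times} {f : Times → V} (hf : SmoothOn U f) (π : V →L[ℝ] W) :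
    SmoothOn U (fun t => π (f t)) :=
  fun t ht N l => hf t ht N (l.comp π)

end General

section Calculus

variable {V : Type*} [NormedAddCommGroup V] [NormedSpace ℝ V]
variable {W : Type*} [NormedAddCommGroup W] [NormedSpace ℝ W]

/-- Openness along each axis allows identities that hold only on `U` to be differentiated. -/
theorem pd_congr {U : Set Times} {f g : Times → V} (hU : IsFinOpen U) (h : Set.EqOn f g U)
    (k : ℕ+) : Set.EqOn (pd k f) (pd k g) U := by
  intro t ht
  refine Filter.EventuallyEq.deriv_eq ?_
  filter_upwards [hU.eventually_single ht k] with r hr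
  exact h hr

/-- Coordinates in a basis are real linear functionals, and finitely many of them determine
smoothness. -/
theorem smoothOn_iff [FiniteDimensional ℝ V] {U : Set Times} {f : Times → V} :
    SmoothOn U f ↔ ∀ t ∈ U, ∀ N : ℕ, ContDiffAt ℝ ∞ (fun s : Fin N → ℝ => f (t + incl s)) 0 := by
  constructor
  · intro h t ht N
    let e : V ≃L[ℝ] (Fin (Module.finrank ℝ V) → ℝ) :=
      (Module.finBasis ℝ V).equivFun.toContinuousLinearEquiv
    rw [← e.comp_contDiffAt_iff, contDiffAt_pi]
    intro i
    exact h t ht N ((ContinuousLinearMap.proj (R := ℝ) (φ := fun _ => ℝ) i).comp (e : V →L[ℝ] _))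
  · intro h t ht N l
    exact l.contDiff.contDiffAt.comp _ (h t ht N)

/-- Restricting to fewer variables is composition with the linear map `extendZero`, so the number of
variables may be enlarged at will. -/
theorem smoothOn_of_le [FiniteDimensional ℝ V] {U : Set Times} {f : Times → V}
    (h : ∀ t ∈ U, ∀ N : ℕ, ∃ N', N ≤ N' ∧
      ContDiffAt ℝ ∞ (fun s : Fin N' → ℝ => f (t + incl s)) 0) : SmoothOn U f := by
  rw [smoothOn_iff]
  intro t ht N
  obtain ⟨N', hN, hc⟩ := h t ht N
  have h2 : ContDiffAt ℝ ∞ ((fun s : Fin N' → ℝ => f (t + incl s)) ∘ extendZero N N') 0 :=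
    ContDiffAt.comp _ (by simpa using hc) (extendZero N N').contDiff.contDiffAt
  simpa [Function.comp_def, incl_extendZero hN] using h2

theorem hasDerivAt_single {f : Times → V} {t : Times} {N : ℕ} {s : Fin N → ℝ}
    (h : DifferentiableAt ℝ (fun s : Fin N → ℝ => f (t + incl s)) s) (i : Fin N) :
    HasDerivAt (fun r : ℝ => f (t + incl s + Pi.single (Nat.succPNat (i : ℕ)) r))
      (fderiv ℝ (fun s : Fin N → ℝ => f (t + incl s)) s (Pi.single i 1)) 0 := by
  have h1 : HasDerivAt (fun r : ℝ => s + r • (Pi.single i 1 : Fin N → ℝ)) (Pi.single i 1) 0 := by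
    simpa using ((hasDerivAt_id (0 : ℝ)).smul_const (Pi.single i 1 : Fin N → ℝ)).const_add s
  have h2 := HasFDerivAt.comp_hasDerivAt (0 : ℝ)
    (l := fun s : Fin N → ℝ => f (t + incl s)) (by simpa using h.hasFDerivAt) h1
  refine h2.congr_of_eventuallyEq (Filter.Eventually.of_forall fun r => ?_)
  simp only [Function.comp_apply]
  rw [incl_add, ← Pi.single_smul, incl_single, add_assoc]
  simp

/-- The identification with a Fréchet derivative is needed on a neighbourhood, not only at `0`: it
is differentiated again for smoothness of `pd` and for the symmetry of second derivatives. -/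
theorem eventually_pd_eq {f : Times → V} {t : Times} {N : ℕ}
    (h : ContDiffAt ℝ ∞ (fun s : Fin N → ℝ => f (t + incl s)) 0) (i : Fin N) :
    (fun s : Fin N → ℝ => pd (Nat.succPNat (i : ℕ)) f (t + incl s)) =ᶠ[𝓝 0]
      fun s => fderiv ℝ (fun s : Fin N → ℝ => f (t + incl s)) s (Pi.single i 1) := by
  have h1 : ContDiffAt ℝ 1 (fun s : Fin N → ℝ => f (t + incl s)) 0 := h.of_le (by simp)
  filter_upwards [h1.eventually (by simp)] with s hs
  exact (hasDerivAt_single (hs.differentiableAt (by simp)) i).deriv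

theorem contDiffAt_pd {f : Times → V} {t : Times} {N : ℕ}
    (h : ContDiffAt ℝ ∞ (fun s : Fin N → ℝ => f (t + incl s)) 0) (i : Fin N) :
    ContDiffAt ℝ ∞ (fun s : Fin N → ℝ => pd (Nat.succPNat (i : ℕ)) f (t + incl s)) 0 := by
  refine ContDiffAt.congr_of_eventuallyEq ?_ (eventually_pd_eq h i)
  exact (h.fderiv_right (m := ∞) (by simp)).clm_apply contDiffAt_const

theorem pd_const_smul (c : ℝ) (f : Times → V) (k : ℕ+) (t : Times) :
    pd k (c • f) t = c • pd k f t := by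
  simp [pd, deriv_fun_const_smul_field]

variable [FiniteDimensional ℝ V]

theorem SmoothOn.pd {U : Set Times} {f : Times → V} (hf : SmoothOn U f) (k : ℕ+) :
    SmoothOn U (pd k f) := by
  -- With `N + k` variables, `t_k` is among those being varied.
  refine smoothOn_of_le fun t ht N => ⟨N + k, by omega, ?_⟩
  have := contDiffAt_pd (smoothOn_iff.1 hf t ht (N + k))
    ⟨k.natPred, by have := PNat.natPred_add_one k; omega⟩
  simpa using this

theorem SmoothOn.hasDerivAt {U : Set Times} {f : Times → V} (hf : SmoothOn U f) {t : Times}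
    (ht : t ∈ U) (k : ℕ+) :
    HasDerivAt (fun r : ℝ => f (t + Pi.single k r)) (RiccatiKP.pd k f t) 0 := by
  have h := smoothOn_iff.1 hf t ht (k.natPred + 1)
  have h1 := hasDerivAt_single (h.differentiableAt (by simp)) (Fin.last k.natPred)
  simp only [incl_zero, add_zero, Fin.val_last, PNat.succPNat_natPred] at h1
  exact h1.differentiableAt.hasDerivAt

theorem SmoothOn.pd_comm {U : Set Times} {f : Times → V} (hf : SmoothOn U f) {t : Times}
    (ht : t ∈ U) (k l : ℕ+) :
    RiccatiKP.pd k (RiccatiKP.pd l f) t = RiccatiKP.pd l (RiccatiKP.pd k f) t := by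
  obtain ⟨N, i, j, hi, hj⟩ : ∃ (N : ℕ) (i j : Fin N), Nat.succPNat (i : ℕ) = k ∧
      Nat.succPNat (j : ℕ) = l :=
    ⟨k + l, ⟨k.natPred, by have := PNat.natPred_add_one k; omega⟩,
      ⟨l.natPred, by have := PNat.natPred_add_one l; omega⟩, by simp, by simp⟩
  subst hi hj
  have h := smoothOn_iff.1 hf t ht N
  have key : ∀ i j : Fin N, RiccatiKP.pd (Nat.succPNat (i : ℕ))
      (RiccatiKP.pd (Nat.succPNat (j : ℕ)) f) t =
      fderiv ℝ (fderiv ℝ (fun s : Fin N → ℝ => f (t + incl s))) 0 (Pi.single i 1)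
        (Pi.single j 1) := by
    intro i j
    have h1 := (eventually_pd_eq (contDiffAt_pd h j) i).self_of_nhds
    simp only [incl_zero, add_zero] at h1
    rw [h1, (eventually_pd_eq h j).fderiv_eq]
    have hd : DifferentiableAt ℝ (fderiv ℝ (fun s : Fin N → ℝ => f (t + incl s))) 0 :=
      (h.fderiv_right (m := ∞) (by simp)).differentiableAt (by simp)
    rw [fderiv_clm_apply hd (differentiableAt_const _)]
    simp
  rw [key, key]
  exact (h.isSymmSndFDerivAt (by simpa using ENat.LEInfty.out)).eq _ _

theorem pd_add {U : Set Times} {f g : Times → V} (hf : SmoothOn U f) (hg : SmoothOn U g)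
    (k : ℕ+) {t : Times} (ht : t ∈ U) : pd k (f + g) t = pd k f t + pd k g t :=
  ((hf.hasDerivAt ht k).add (hg.hasDerivAt ht k)).deriv

theorem pd_sub {U : Set Times} {f g : Times → V} (hf : SmoothOn U f) (hg : SmoothOn U g)
    (k : ℕ+) {t : Times} (ht : t ∈ U) : pd k (f - g) t = pd k f t - pd k g t :=
  ((hf.hasDerivAt ht k).sub (hg.hasDerivAt ht k)).deriv

theorem pd_sum {U : Set Times} {ι : Type*} {s : Finset ι} {f : ι → Times → V}
    (hf : ∀ i ∈ s, SmoothOn U (f i)) (k : ℕ+) {t : Times} (ht : t ∈ U) :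
    pd k (∑ i ∈ s, f i) t = ∑ i ∈ s, pd k (f i) t := by
  have := (HasDerivAt.fun_sum fun i hi => (hf i hi).hasDerivAt ht k).deriv
  rw [← this, pd]
  simp

theorem pd_clm {U : Set Times} {f : Times → V} (hf : SmoothOn U f) (π : V →L[ℝ] W)
    (k : ℕ+) {t : Times} (ht : t ∈ U) : pd k (fun t => π (f t)) t = π (pd k f t) :=
  (π.hasFDerivAt.comp_hasDerivAt (0 : ℝ) (hf.hasDerivAt ht k)).deriv

theorem SmoothOn.bilin {X : Type*} [NormedAddCommGroup X] [NormedSpace ℝ X]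
    [FiniteDimensional ℝ W] [FiniteDimensional ℝ X] {U : Set Times} {f : Times → V} {g : Times → W}
    (hf : SmoothOn U f) (hg : SmoothOn U g) (b : V →L[ℝ] W →L[ℝ] X) :
    SmoothOn U (fun t => b (f t) (g t)) := by
  rw [smoothOn_iff] at *
  intro t ht N
  exact (b.contDiff.contDiffAt.comp _ (hf t ht N)).clm_apply (hg t ht N)

theorem pd_bilin {X : Type*} [NormedAddCommGroup X] [NormedSpace ℝ X] [FiniteDimensional ℝ W]
    {U : Set Times} {f : Times → V} {g : Times → W} (hf : SmoothOn U f) (hg : SmoothOn U g)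
    (b : V →L[ℝ] W →L[ℝ] X) (k : ℕ+) {t : Times} (ht : t ∈ U) :
    pd k (fun t => b (f t) (g t)) t = b (pd k f t) (g t) + b (f t) (pd k g t) := by
  have h := (b.hasFDerivAt.comp_hasDerivAt (0 : ℝ) (hf.hasDerivAt ht k)).clm_apply
    (hg.hasDerivAt ht k)
  simp only [Pi.single_zero, add_zero, Function.comp_apply] at h
  exact h.deriv

end Calculus

/-! ### Coefficients of the formal shift: linearity and commutation. -/

section ShiftCoeff

variable {V : Type*} [AddCommGroup V] [Module ℝ V] [TopologicalSpace V]

theorem shiftCoeff_zero (f : Times → V) : shiftCoeff f 0 = f := by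
  rw [shiftCoeff]

theorem shiftCoeff_succ (f : Times → V) (k : ℕ) :
    shiftCoeff f (k + 1) = ((k : ℝ) + 1)⁻¹ •
      ∑ j ∈ Finset.range (k + 1), pd (Nat.succPNat j) (shiftCoeff f (k - j)) := by
  funext t
  rw [shiftCoeff, Finset.sum_range]
  simp

end ShiftCoeff

section ShiftCoeff

variable {V : Type*} [NormedAddCommGroup V] [NormedSpace ℝ V]
variable {W : Type*} [NormedAddCommGroup W] [NormedSpace ℝ W]

theorem shiftCoeff_zero_fun (k : ℕ) : shiftCoeff (0 : Times → V) k = 0 := by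
  induction k using Nat.strong_induction_on with
  | _ k ih =>
    cases k with
    | zero => rw [shiftCoeff_zero]
    | succ k =>
      rw [shiftCoeff_succ, Finset.sum_eq_zero, smul_zero]
      intro j _
      rw [ih (k - j) (by omega)]
      funext t
      simp [pd]

theorem shiftCoeff_congr {U : Set Times} (hU : IsFinOpen U) {f g : Times → V}
    (h : Set.EqOn f g U) (k : ℕ) : Set.EqOn (shiftCoeff f k) (shiftCoeff g k) U := by
  induction k using Nat.strong_induction_on with
  | _ k ih =>
    cases k with
    | zero => simpa only [shiftCoeff_zero] using h
    | succ k =>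
      intro t ht
      simp only [shiftCoeff_succ, Pi.smul_apply, Finset.sum_apply]
      congr 1
      exact Finset.sum_congr rfl fun j _ => pd_congr hU (ih (k - j) (by omega)) _ ht

theorem SmoothOn.const_smul {U : Set Times} {f : Times → V} (hf : SmoothOn U f) (c : ℝ) :
    SmoothOn U (c • f) :=
  hf.clm (c • ContinuousLinearMap.id ℝ V)

variable [FiniteDimensional ℝ V]

theorem SmoothOn.shiftCoeff {U : Set Times} {f : Times → V} (hf : SmoothOn U f) (k : ℕ) :
    SmoothOn U (shiftCoeff f k) := by
  induction k using Nat.strong_induction_on with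
  | _ k ih =>
    cases k with
    | zero => rwa [shiftCoeff_zero]
    | succ k =>
      rw [shiftCoeff_succ]
      exact (SmoothOn.sum fun j _ => (ih (k - j) (by omega)).pd _).const_smul _

theorem shiftCoeff_add {U : Set Times} (hU : IsFinOpen U) {f g : Times → V}
    (hf : SmoothOn U f) (hg : SmoothOn U g) (k : ℕ) :
    Set.EqOn (shiftCoeff (f + g) k) (shiftCoeff f k + shiftCoeff g k) U := by
  induction k using Nat.strong_induction_on with
  | _ k ih =>
    cases k with
    | zero => intro t _; simp only [shiftCoeff_zero]
    | succ k =>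
      intro t ht
      simp only [shiftCoeff_succ, Pi.add_apply, Pi.smul_apply, Finset.sum_apply]
      rw [← smul_add, ← Finset.sum_add_distrib]
      congr 1
      refine Finset.sum_congr rfl fun j _ => ?_
      rw [pd_congr hU (ih (k - j) (by omega)) _ ht,
        pd_add (hf.shiftCoeff _) (hg.shiftCoeff _) _ ht]

theorem shiftCoeff_sum {U : Set Times} (hU : IsFinOpen U) {ι : Type*} {s : Finset ι}
    {f : ι → Times → V} (hf : ∀ i ∈ s, SmoothOn U (f i)) (k : ℕ) :
    Set.EqOn (shiftCoeff (∑ i ∈ s, f i) k) (∑ i ∈ s, shiftCoeff (f i) k) U := by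
  classical
  induction s using Finset.induction_on with
  | empty => intro t _; simp [shiftCoeff_zero_fun]
  | insert a s ha ih =>
    intro t ht
    rw [Finset.sum_insert ha, Finset.sum_insert ha,
      shiftCoeff_add hU (hf a (by simp)) (SmoothOn.sum fun i hi => hf i (by simp [hi])) k ht,
      Pi.add_apply, Pi.add_apply, ih (fun i hi => hf i (by simp [hi])) ht]

theorem shiftCoeff_clm {U : Set Times} (hU : IsFinOpen U) {f : Times → V} (hf : SmoothOn U f)
    (π : V →L[ℝ] W) (k : ℕ) :
    Set.EqOn (shiftCoeff (fun t => π (f t)) k) (fun t => π (shiftCoeff f k t)) U := by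
  induction k using Nat.strong_induction_on with
  | _ k ih =>
    cases k with
    | zero => intro t _; simp only [shiftCoeff_zero]
    | succ k =>
      intro t ht
      simp only [shiftCoeff_succ, Pi.smul_apply, Finset.sum_apply, map_smul, map_sum]
      congr 1
      refine Finset.sum_congr rfl fun j _ => ?_
      rw [pd_congr hU (ih (k - j) (by omega)) _ ht, pd_clm (hf.shiftCoeff _) _ _ ht]

theorem shiftCoeff_pd {U : Set Times} (hU : IsFinOpen U) {f : Times → V} (hf : SmoothOn U f)
    (l : ℕ+) (k : ℕ) : Set.EqOn (shiftCoeff (pd l f) k) (pd l (shiftCoeff f k)) U := by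
  induction k using Nat.strong_induction_on with
  | _ k ih =>
    cases k with
    | zero => intro t _; simp only [shiftCoeff_zero]
    | succ k =>
      intro t ht
      simp only [shiftCoeff_succ]
      rw [pd_const_smul, pd_sum (fun j _ => (hf.shiftCoeff _).pd _) _ ht]
      simp only [Pi.smul_apply, Finset.sum_apply]
      congr 1
      refine Finset.sum_congr rfl fun j _ => ?_
      rw [pd_congr hU (ih (k - j) (by omega)) _ ht, (hf.shiftCoeff _).pd_comm ht]

/-- Each coefficient is a polynomial in the commuting operators `∂_{t_j}`; strong induction on `b`
reduces the claim to `shiftCoeff_pd`. -/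
theorem shiftCoeff_comm {U : Set Times} (hU : IsFinOpen U) {f : Times → V} (hf : SmoothOn U f)
    (a b : ℕ) : Set.EqOn (shiftCoeff (shiftCoeff f a) b) (shiftCoeff (shiftCoeff f b) a) U := by
  induction b using Nat.strong_induction_on with
  | _ b ih =>
    cases b with
    | zero => intro t _; simp only [shiftCoeff_zero]
    | succ b =>
      intro t ht
      have h1 := shiftCoeff_clm hU
        (SmoothOn.sum (s := Finset.range (b + 1)) fun j _ => (hf.shiftCoeff (b - j)).pd
          (Nat.succPNat j)) (((b : ℝ) + 1)⁻¹ • ContinuousLinearMap.id ℝ V) a ht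
      rw [shiftCoeff_succ, shiftCoeff_succ f b]
      refine Eq.trans ?_ h1.symm
      simp only [_root_.smul_apply, ContinuousLinearMap.id_apply, Pi.smul_apply,
        Finset.sum_apply]
      congr 1
      rw [shiftCoeff_sum hU (fun j _ => (hf.shiftCoeff (b - j)).pd (Nat.succPNat j)) a ht,
        Finset.sum_apply]
      refine Finset.sum_congr rfl fun j _ => ?_
      rw [pd_congr hU (ih (b - j) (by omega)) _ ht, shiftCoeff_pd hU (hf.shiftCoeff _) _ _ ht]

end ShiftCoeff

/-! ### Shifts of formal series in three indeterminates. -/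

namespace FormalSeries

variable {V : Type*} [NormedAddCommGroup V] [NormedSpace ℝ V]
variable {W : Type*} [NormedAddCommGroup W] [NormedSpace ℝ W]

/-- Shifting a constant series by `lam_i` produces pure powers of `lam_i` only. -/
theorem shift_const (i : Fin 3) (φ : Times → V) (d : Fin 3 →₀ ℕ) :
    shift i (const φ) d = if d = Finsupp.single i (d i) then shiftCoeff φ (d i) else 0 := by
  have hz : ∀ k ∈ Finset.range (d i + 1), d - Finsupp.single i k = 0 →
      d = Finsupp.single i (d i) ∧ k = d i := by
    intro k hk h
    rw [Finset.mem_range] at hk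
    have hle : d ≤ Finsupp.single i k := tsub_eq_zero_iff_le.1 h
    have hki : k = d i := by
      have := hle i
      rw [Finsupp.single_eq_same] at this
      omega
    refine ⟨le_antisymm (hki ▸ hle) ?_, hki⟩
    rw [Finsupp.single_le_iff]
  rw [shift]
  split_ifs with h
  · rw [Finset.sum_eq_single (d i)]
    · rw [const, if_pos]
      nth_rewrite 1 [h]
      simp
    · intro k hk hne
      rw [const, if_neg fun h0 => hne (hz k hk h0).2, shiftCoeff_zero_fun]
    · simp
  · refine Finset.sum_eq_zero fun k hk => ?_
    rw [const, if_neg fun h0 => h (hz k hk h0).1, shiftCoeff_zero_fun]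

theorem shift_congr {U : Set Times} (hU : IsFinOpen U) {F G : FormalSeries V}
    (h : ∀ d, Set.EqOn (F d) (G d) U) (i : Fin 3) (d : Fin 3 →₀ ℕ) :
    Set.EqOn (shift i F d) (shift i G d) U := by
  intro t ht
  simp only [shift, Finset.sum_apply]
  exact Finset.sum_congr rfl fun k _ => shiftCoeff_congr hU (h _) _ ht

theorem smoothOn_const_series {U : Set Times} {φ : Times → V} (hφ : SmoothOn U φ)
    (d : Fin 3 →₀ ℕ) : SmoothOn U (const φ d) := by
  rw [const]
  split_ifs
  · exact hφ
  · exact smoothOn_const U 0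

variable [FiniteDimensional ℝ V]

theorem smoothOn_shift {U : Set Times} {F : FormalSeries V} (hF : ∀ d, SmoothOn U (F d))
    (i : Fin 3) (d : Fin 3 →₀ ℕ) : SmoothOn U (shift i F d) :=
  SmoothOn.sum fun _ _ => (hF _).shiftCoeff _

theorem shift_add {U : Set Times} (hU : IsFinOpen U) {F G : FormalSeries V}
    (hF : ∀ d, SmoothOn U (F d)) (hG : ∀ d, SmoothOn U (G d)) (i : Fin 3) (d : Fin 3 →₀ ℕ) :
    Set.EqOn (shift i (F + G) d) (shift i F d + shift i G d) U := by
  intro t ht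
  simp only [shift, Pi.add_apply, Finset.sum_apply, ← Finset.sum_add_distrib]
  exact Finset.sum_congr rfl fun k _ => shiftCoeff_add hU (hF _) (hG _) _ ht

theorem shift_clm {U : Set Times} (hU : IsFinOpen U) {F : FormalSeries V}
    (hF : ∀ d, SmoothOn U (F d)) (π : V →L[ℝ] W) (i : Fin 3) (d : Fin 3 →₀ ℕ) :
    Set.EqOn (shift i (fun d t => π (F d t)) d) (fun t => π (shift i F d t)) U := by
  intro t ht
  simp only [shift, Finset.sum_apply, map_sum]
  exact Finset.sum_congr rfl fun k _ => shiftCoeff_clm hU (hF _) π _ ht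

theorem shift_comm {U : Set Times} (hU : IsFinOpen U) {F : FormalSeries V}
    (hF : ∀ d, SmoothOn U (F d)) {i j : Fin 3} (hij : i ≠ j) (d : Fin 3 →₀ ℕ) :
    Set.EqOn (shift i (shift j F) d) (shift j (shift i F) d) U := by
  have key : ∀ {i j : Fin 3}, i ≠ j → ∀ t ∈ U, shift i (shift j F) d t =
      ∑ a ∈ Finset.range (d i + 1), ∑ b ∈ Finset.range (d j + 1),
        shiftCoeff (shiftCoeff (F (d - Finsupp.single i a - Finsupp.single j b)) b) a t := by
    intro i j hij t ht
    rw [shift, Finset.sum_apply]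
    refine Finset.sum_congr rfl fun a _ => ?_
    -- Since `i ≠ j`, the range of the inner sum does not depend on `a`, so the double sum can be
    -- interchanged.
    have hd : (d - Finsupp.single i a) j = d j := by
      simp [Finsupp.single_eq_of_ne hij.symm]
    rw [shift, hd, shiftCoeff_sum hU (fun b _ => (hF _).shiftCoeff _) _ ht, Finset.sum_apply]
  intro t ht
  rw [key hij t ht, key hij.symm t ht, Finset.sum_comm]
  refine Finset.sum_congr rfl fun b _ => Finset.sum_congr rfl fun a _ => ?_
  rw [shiftCoeff_comm hU (hF _) _ _ ht, tsub_right_comm]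

end FormalSeries

/-! ### Criteria for solving the pKP hierarchy. -/

section PKP

open FormalSeries

/-- Reindexing by the odd permutation `τ` turns the sum into its negative. -/
theorem sum_perm_eq_zero {V : Type*} [AddCommGroup V] [Module ℝ V]
    (g : Equiv.Perm (Fin 3) → V) (τ : Equiv.Perm (Fin 3)) (hτ : Equiv.Perm.sign τ = -1)
    (h : ∀ σ, g (σ * τ) = g σ) :
    ∑ σ : Equiv.Perm (Fin 3), (Equiv.Perm.sign σ : ℤ) • g σ = 0 := by
  have h1 : ∑ σ : Equiv.Perm (Fin 3), (Equiv.Perm.sign σ : ℤ) • g σ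
      = -∑ σ : Equiv.Perm (Fin 3), (Equiv.Perm.sign σ : ℤ) • g σ := by
    conv_lhs => rw [← Equiv.sum_comp (Equiv.mulRight τ)]
    rw [← Finset.sum_neg_distrib]
    refine Finset.sum_congr rfl fun σ _ => ?_
    simp [hτ, h]
  have h2 : (2 : ℝ) • ∑ σ : Equiv.Perm (Fin 3), (Equiv.Perm.sign σ : ℤ) • g σ = 0 := by
    rw [two_smul]
    nth_rewrite 1 [h1]
    simp
  simpa using h2

variable {V : Type*} [NormedAddCommGroup V] [NormedSpace ℝ V] [FiniteDimensional ℝ V]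
variable {W : Type*} [NormedAddCommGroup W] [NormedSpace ℝ W]

/-- A function whose formal shift satisfies
`lam⁻¹ (φ_{[lam]} - φ) + φ ∘ φ_{[lam]} = ψ + A φ_{[lam]}` with a linear map `A` and a function `ψ`
which does not depend on `lam` solves the pKP hierarchy. -/
theorem isPKPSolution_of_shiftCoeff {mul : V → V → V} (hmul : ∀ a, mul a 0 = 0) {U : Set Times}
    (hU : IsFinOpen U) {φ ψ : Times → V} (hφ : SmoothOn U φ) (hψ : SmoothOn U ψ) (A : V →L[ℝ] V)
    (h : ∀ k, ∀ t ∈ U, shiftCoeff φ (k + 1) t + mul (φ t) (shiftCoeff φ k t)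
      = (if k = 0 then ψ t else 0) + A (shiftCoeff φ k t)) :
    IsPKPSolution mul U φ := by
  refine ⟨hU, hφ, ?_⟩
  have hterm : ∀ i d, Set.EqOn (pkpTerm mul φ i d)
      ((const ψ + fun d t => A (shift i (const φ) d t) : FormalSeries V) d) U := by
    intro i d t ht
    -- The subtracted `φ` sits in degree `0`, which is never reached after dividing by `lam_i`.
    have hd1 : d + Finsupp.single i 1 ≠ 0 := by
      intro h0
      have := DFunLike.congr_fun h0 i
      simp at this
    have hd2 : d + Finsupp.single i 1 =
        Finsupp.single i ((d + Finsupp.single i 1 : Fin 3 →₀ ℕ) i) ↔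
        d = Finsupp.single i (d i) := by
      rw [Finsupp.add_apply, Finsupp.single_eq_same, Finsupp.single_add, add_left_inj]
    simp only [pkpTerm, divX, lmul, Pi.add_apply, Pi.sub_apply, shift_const, hd2]
    simp only [const, if_neg hd1]
    by_cases hd : d = Finsupp.single i (d i)
    · have hd0 : d = 0 ↔ d i = 0 := by
        rw [hd]; simp
      have := h (d i) t ht
      simp only [← hd, if_true, hd0, Pi.zero_apply, sub_zero, Finsupp.add_apply,
        Finsupp.single_eq_same, this]
      split_ifs <;> rfl
    · have hd0 : d ≠ 0 := by rintro rfl; simp at hd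
      simp [hd, hd0, hmul]
  have hsm := smoothOn_const_series hφ
  intro d t ht
  have hshift : ∀ i k, shift k (pkpTerm mul φ i) d t
      = shift k (const ψ) d t + A (shift k (shift i (const φ)) d t) := by
    intro i k
    rw [shift_congr hU (hterm i) k d ht,
      shift_add hU (smoothOn_const_series hψ) (fun d => (smoothOn_shift hsm i d).clm A) k d ht,
      Pi.add_apply, shift_clm hU (smoothOn_shift hsm i) A k d ht]
  simp only [pkpSeries, Finset.sum_apply, Pi.smul_apply, hshift, smul_add,
    Finset.sum_add_distrib]
  -- The `ψ` term sees only `σ 2`, so it is fixed by swapping `0, 1`; the `A` term carries two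
  -- commuting shifts, so it is fixed by swapping `0, 2`.
  rw [sum_perm_eq_zero (fun σ => shift (σ 2) (const ψ) d t) (Equiv.swap 0 1) (by decide),
    sum_perm_eq_zero (fun σ => A (shift (σ 2) (shift (σ 0) (const φ)) d t)) (Equiv.swap 0 2)
      (by decide), add_zero]
  · intro σ
    simp only [Equiv.Perm.coe_mul, Function.comp_apply, Equiv.swap_apply_left,
      Equiv.swap_apply_right]
    rw [shift_comm hU hsm (by simp) d ht]
  · intro σ
    simp only [Equiv.Perm.coe_mul, Function.comp_apply]
    rw [Equiv.swap_apply_of_ne_of_ne (by decide) (by decide)]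

/-- Homomorphisms map solutions of the pKP hierarchy to solutions of the pKP hierarchy. -/
theorem IsPKPSolution.map {mul : V → V → V} {mul' : W → W → W} (π : V →L[ℝ] W)
    (hπ : ∀ a b, π (mul a b) = mul' (π a) (π b))
    (hmul : ∀ (U : Set Times) (f g : Times → V), SmoothOn U f → SmoothOn U g →
      SmoothOn U (fun t => mul (f t) (g t)))
    {U : Set Times} {φ : Times → V} (h : IsPKPSolution mul U φ) :
    IsPKPSolution mul' U (fun t => π (φ t)) := by
  obtain ⟨hU, hφ, heq⟩ := h
  refine ⟨hU, hφ.clm π, fun d t ht => ?_⟩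
  have hconst : const (fun t => π (φ t)) = fun d t => π (const φ d t) := by
    funext d t
    simp only [const]
    split_ifs <;> simp
  have hsm := smoothOn_const_series hφ
  have hterm : ∀ i d, Set.EqOn (pkpTerm mul' (fun t => π (φ t)) i d)
      (fun t => π (pkpTerm mul φ i d t)) U := by
    intro i d t ht
    simp only [pkpTerm, divX, lmul, Pi.add_apply, Pi.sub_apply, hconst, map_add, map_sub, hπ]
    rw [shift_clm hU hsm π i _ ht, shift_clm hU hsm π i _ ht]
  have htsm : ∀ i d, SmoothOn U (pkpTerm mul φ i d) := fun i d =>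
    ((smoothOn_shift hsm i _).sub (hsm _)).add (hmul U _ _ hφ (smoothOn_shift hsm i d))
  have h0 := congrArg π (heq d t ht)
  simp only [pkpSeries, Finset.sum_apply, Pi.smul_apply, map_sum, map_zsmul, map_zero] at h0 ⊢
  rw [← h0]
  refine Finset.sum_congr rfl fun σ _ => ?_
  rw [shift_congr hU (hterm (σ 0)) (σ 2) d ht, shift_clm hU (htsm (σ 0)) π (σ 2) d ht]

end PKP

open Matrix

/-! ### Product rule and pKP criteria for matrix-valued functions. -/

section MatrixCalculus

variable {a b c : Type*} [Fintype a] [Fintype b] [Fintype c]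

/-- Matrix multiplication as a continuous real bilinear map. -/
noncomputable def matrixMulCLM (a b c : Type*) [Fintype a] [Fintype b] [Fintype c] :
    Matrix a b ℂ →L[ℝ] Matrix b c ℂ →L[ℝ] Matrix a c ℂ :=
  open scoped Matrix.Norms.Operator in
  LinearMap.mkContinuous₂
    (LinearMap.mk₂ ℝ (fun (A : Matrix a b ℂ) (B : Matrix b c ℂ) => A * B) Matrix.add_mul
      Matrix.smul_mul Matrix.mul_add fun r A B => Matrix.mul_smul A r B)
    1 fun A B => by simpa using Matrix.linfty_opNorm_mul A B

theorem SmoothOn.matrix_mul {U : Set Times} {f : Times → Matrix a b ℂ} {g : Times → Matrix b c ℂ}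
    (hf : SmoothOn U f) (hg : SmoothOn U g) : SmoothOn U (fun t => f t * g t) :=
  open scoped Matrix.Norms.Operator in
  hf.bilin hg (matrixMulCLM a b c)

theorem pd_matrix_mul {U : Set Times} {f : Times → Matrix a b ℂ} {g : Times → Matrix b c ℂ}
    (hf : SmoothOn U f) (hg : SmoothOn U g) (k : ℕ+) {t : Times} (ht : t ∈ U) :
    pd k (fun t => f t * g t) t = pd k f t * g t + f t * pd k g t :=
  open scoped Matrix.Norms.Operator in
  pd_bilin hf hg (matrixMulCLM a b c) k ht

theorem pd_matrix_add {U : Set Times} {f g : Times → Matrix a b ℂ}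
    (hf : SmoothOn U f) (hg : SmoothOn U g) (k : ℕ+) {t : Times} (ht : t ∈ U) :
    pd k (fun t => f t + g t) t = pd k f t + pd k g t :=
  open scoped Matrix.Norms.Operator in
  pd_add hf hg k ht

theorem pd_matrix_sub {U : Set Times} {f g : Times → Matrix a b ℂ}
    (hf : SmoothOn U f) (hg : SmoothOn U g) (k : ℕ+) {t : Times} (ht : t ∈ U) :
    pd k (fun t => f t - g t) t = pd k f t - pd k g t :=
  open scoped Matrix.Norms.Operator in
  pd_sub hf hg k ht

theorem pd_matrix_congr {U : Set Times} {f g : Times → Matrix a b ℂ} (hU : IsFinOpen U)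
    (h : Set.EqOn f g U) (k : ℕ+) : Set.EqOn (pd k f) (pd k g) U :=
  open scoped Matrix.Norms.Operator in
  pd_congr hU h k

theorem pd_matrix_const (A : Matrix a b ℂ) (k : ℕ+) (t : Times) : pd k (fun _ => A) t = 0 :=
  open scoped Matrix.Norms.Operator in
  deriv_const 0 A

theorem isPKPSolution_matrix_of_shiftCoeff {mul : Matrix a b ℂ → Matrix a b ℂ → Matrix a b ℂ}
    (hmul : ∀ A, mul A 0 = 0) {U : Set Times} (hU : IsFinOpen U) {φ ψ : Times → Matrix a b ℂ}
    (hφ : SmoothOn U φ) (hψ : SmoothOn U ψ) (A : Matrix a a ℂ)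
    (h : ∀ k, ∀ t ∈ U, shiftCoeff φ (k + 1) t + mul (φ t) (shiftCoeff φ k t)
      = (if k = 0 then ψ t else 0) + A * shiftCoeff φ k t) :
    IsPKPSolution mul U φ :=
  open scoped Matrix.Norms.Operator in
  isPKPSolution_of_shiftCoeff hmul hU hφ hψ (matrixMulCLM a a b A) h

theorem IsPKPSolution.map_matrix {mul : Matrix a b ℂ → Matrix a b ℂ → Matrix a b ℂ}
    {mul' : ℂ → ℂ → ℂ} (π : Matrix a b ℂ →L[ℝ] ℂ) (hπ : ∀ A B, π (mul A B) = mul' (π A) (π B))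
    (hmul : ∀ (U : Set Times) (f g : Times → Matrix a b ℂ), SmoothOn U f → SmoothOn U g →
      SmoothOn U (fun t => mul (f t) (g t)))
    {U : Set Times} {φ : Times → Matrix a b ℂ} (h : IsPKPSolution mul U φ) :
    IsPKPSolution mul' U (fun t => π (φ t)) :=
  open scoped Matrix.Norms.Operator in
  IsPKPSolution.map π hπ hmul h

end MatrixCalculus

/-! ### From the matrix Riccati hierarchy to pKP. -/

section Riccati

variable {m n : Type*} [Fintype m] [DecidableEq m] [Fintype n] [DecidableEq n]

/-- The right-hand side `S_k + L_k X - X R_k - X Q_k X` of the `k`-th Riccati equation. -/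
noncomputable def riccatiRHS (H : Matrix (n ⊕ m) (n ⊕ m) ℂ) (k : ℕ) (X : Matrix m n ℂ) :
    Matrix m n ℂ :=
  (H ^ k).toBlocks₂₁ + (H ^ k).toBlocks₂₂ * X - X * (H ^ k).toBlocks₁₁
    - X * (H ^ k).toBlocks₁₂ * X

variable (S : Matrix m n ℂ) (L : Matrix m m ℂ) (R : Matrix n n ℂ) (Q : Matrix n m ℂ)

theorem fromBlocks_pow_succ (k : ℕ) :
    fromBlocks R Q S L ^ (k + 1) = fromBlocks
      ((fromBlocks R Q S L ^ k).toBlocks₁₁ * R + (fromBlocks R Q S L ^ k).toBlocks₁₂ * S)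
      ((fromBlocks R Q S L ^ k).toBlocks₁₁ * Q + (fromBlocks R Q S L ^ k).toBlocks₁₂ * L)
      ((fromBlocks R Q S L ^ k).toBlocks₂₁ * R + (fromBlocks R Q S L ^ k).toBlocks₂₂ * S)
      ((fromBlocks R Q S L ^ k).toBlocks₂₁ * Q + (fromBlocks R Q S L ^ k).toBlocks₂₂ * L) := by
  rw [← fromBlocks_multiply, fromBlocks_toBlocks, pow_succ]

theorem riccatiRHS_zero (X : Matrix m n ℂ) : riccatiRHS (fromBlocks R Q S L) 0 X = 0 := by
  rw [riccatiRHS, pow_zero, ← fromBlocks_one]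
  simp only [toBlocks_fromBlocks₁₁, toBlocks_fromBlocks₁₂, toBlocks_fromBlocks₂₁,
    toBlocks_fromBlocks₂₂]
  simp

theorem riccatiRHS_one (X : Matrix m n ℂ) :
    riccatiRHS (fromBlocks R Q S L) 1 X = S + L * X - X * R - X * Q * X := by
  simp [riccatiRHS]

/-- The right-hand side is the sandwich `(-X 1) H^k (1; X)`. One more factor `H` gives `H (1; X) =
(1; X) (R + Q X) + (0; 1) ρ_1`, and `(-X 1) H^k (0; 1)` is the block difference in the second term.
-/
theorem riccatiRHS_succ (k : ℕ) (X : Matrix m n ℂ) :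
    riccatiRHS (fromBlocks R Q S L) (k + 1) X
      = riccatiRHS (fromBlocks R Q S L) k X * (R + Q * X)
        + ((fromBlocks R Q S L ^ k).toBlocks₂₂ - X * (fromBlocks R Q S L ^ k).toBlocks₁₂)
          * riccatiRHS (fromBlocks R Q S L) 1 X := by
  rw [riccatiRHS_one, riccatiRHS, riccatiRHS, fromBlocks_pow_succ]
  simp only [toBlocks_fromBlocks₁₁, toBlocks_fromBlocks₁₂, toBlocks_fromBlocks₂₁,
    toBlocks_fromBlocks₂₂, Matrix.mul_add, Matrix.add_mul, Matrix.mul_sub, Matrix.sub_mul,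
    Matrix.mul_assoc]
  abel

/-- Unrolls the recursion obtained from `H (0; 1) = (1; X) Q + (0; 1) (L - X Q)` after
multiplication by `(-X 1) H^k`. -/
theorem riccati_block_eq_sum (k : ℕ) (X : Matrix m n ℂ) :
    (fromBlocks R Q S L ^ k).toBlocks₂₂ - X * (fromBlocks R Q S L ^ k).toBlocks₁₂
      = (L - X * Q) ^ k + ∑ j ∈ Finset.range k,
        riccatiRHS (fromBlocks R Q S L) j X * Q * (L - X * Q) ^ (k - 1 - j) := by
  induction k with
  | zero =>
    rw [pow_zero, ← fromBlocks_one, toBlocks_fromBlocks₁₂, toBlocks_fromBlocks₂₂]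
    simp
  | succ k ih =>
    have h : (fromBlocks R Q S L ^ (k + 1)).toBlocks₂₂
          - X * (fromBlocks R Q S L ^ (k + 1)).toBlocks₁₂
        = riccatiRHS (fromBlocks R Q S L) k X * Q
          + ((fromBlocks R Q S L ^ k).toBlocks₂₂ - X * (fromBlocks R Q S L ^ k).toBlocks₁₂)
            * (L - X * Q) := by
      rw [riccatiRHS, fromBlocks_pow_succ]
      simp only [toBlocks_fromBlocks₁₂, toBlocks_fromBlocks₂₂, Matrix.mul_add, Matrix.add_mul,
        Matrix.mul_sub, Matrix.sub_mul, Matrix.mul_assoc]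
      abel
    have hsum : ∀ j ∈ Finset.range k,
        riccatiRHS (fromBlocks R Q S L) j X * Q * (L - X * Q) ^ (k - 1 - j) * (L - X * Q)
          = riccatiRHS (fromBlocks R Q S L) j X * Q * (L - X * Q) ^ (k - j) := by
      intro j hj
      rw [Finset.mem_range] at hj
      rw [Matrix.mul_assoc _ _ (L - X * Q), ← pow_succ, show k - 1 - j + 1 = k - j by omega]
    rw [h, ih, Matrix.add_mul, ← pow_succ, Matrix.sum_mul, Finset.sum_congr rfl hsum,
      Finset.sum_range_succ]
    simp only [Nat.add_sub_cancel, Nat.sub_self, pow_zero, Matrix.mul_one]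
    abel

/-- The coefficients of the formal shift of a solution of the Riccati hierarchy. -/
noncomputable def riccatiCoeff (φ : Times → Matrix m n ℂ) : ℕ → Times → Matrix m n ℂ
  | 0 => φ
  | k + 1 => fun t => (L - φ t * Q) ^ k * riccatiRHS (fromBlocks R Q S L) 1 (φ t)

theorem riccatiCoeff_add_two (φ : Times → Matrix m n ℂ) (k : ℕ) :
    riccatiCoeff S L R Q φ (k + 2)
      = fun t => (L - φ t * Q) * riccatiCoeff S L R Q φ (k + 1) t := by
  funext t
  simp only [riccatiCoeff, pow_succ' _ k, Matrix.mul_assoc]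

variable {S L R Q} {U : Set Times} {φ : Times → Matrix m n ℂ}

theorem smoothOn_riccatiCoeff (hφ : SmoothOn U φ) (k : ℕ) :
    SmoothOn U (riccatiCoeff S L R Q φ k) := by
  have hL := smoothOn_const U L
  have hQ := smoothOn_const U Q
  have hA : SmoothOn U (fun t => L - φ t * Q) := hL.sub (hφ.matrix_mul hQ)
  have h1 : SmoothOn U (riccatiCoeff S L R Q φ 1) := by
    have : SmoothOn U (fun t => S + L * φ t - φ t * R - φ t * Q * φ t) :=
      (((smoothOn_const U S).add (hL.matrix_mul hφ)).sub (hφ.matrix_mul (smoothOn_const U R))).sub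
        ((hφ.matrix_mul hQ).matrix_mul hφ)
    simpa only [riccatiCoeff, riccatiRHS_one, pow_zero, Matrix.one_mul] using this
  match k with
  | 0 => exact hφ
  | k + 1 =>
    induction k with
    | zero => exact h1
    | succ k ih =>
      rw [riccatiCoeff_add_two]
      exact hA.matrix_mul ih

/-- This is the recursion defining `shiftCoeff`, checked for the closed formula. In the induction
step the product rule pulls out a factor `A = L - φ Q`, which reproduces the previous sum. The
correction terms cancel against the expansion of `ρ_{k+2}`, leaving exactly one extra copy of
`A^(k+1) ρ_1`. -/
theorem sum_pd_riccatiCoeff (h : IsRiccatiSolution (fromBlocks R Q S L) U φ) (k : ℕ)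
    {t : Times} (ht : t ∈ U) :
    ∑ j ∈ Finset.range (k + 1), pd (Nat.succPNat j) (riccatiCoeff S L R Q φ (k - j)) t
      = ((k : ℝ) + 1) • riccatiCoeff S L R Q φ (k + 1) t := by
  obtain ⟨hU, hφ, heq⟩ := h
  have hpd : ∀ j, pd (Nat.succPNat j) φ t = riccatiRHS (fromBlocks R Q S L) (j + 1) (φ t) :=
    fun j => heq _ t ht
  have hL := smoothOn_const U L
  have hQ := smoothOn_const U Q
  have hA : SmoothOn U (fun t => L - φ t * Q) := hL.sub (hφ.matrix_mul hQ)
  have hpdA : ∀ j, pd (Nat.succPNat j) (fun t => L - φ t * Q) t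
      = -(riccatiRHS (fromBlocks R Q S L) (j + 1) (φ t) * Q) := by
    intro j
    rw [pd_matrix_sub hL (hφ.matrix_mul hQ) _ ht, pd_matrix_mul hφ hQ _ ht, pd_matrix_const,
      pd_matrix_const, hpd]
    simp
  induction k with
  | zero => simp [hpd, riccatiCoeff]
  | succ k ih =>
    set X := φ t with hX
    set A := L - X * Q with hAdef
    -- The summand `j = k` is treated apart: `c_1` is not `A c_0`, but `S + A φ - φ R`.
    have hB : pd (Nat.succPNat k) (riccatiCoeff S L R Q φ 1) t
        = A * riccatiRHS (fromBlocks R Q S L) (k + 1) X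
          - riccatiRHS (fromBlocks R Q S L) (k + 1) X * (R + Q * X) := by
      have hR := smoothOn_const U R
      have hS := smoothOn_const U S
      have h1 : riccatiCoeff S L R Q φ 1 = fun t => (S + (L - φ t * Q) * φ t) - φ t * R := by
        funext t
        simp only [riccatiCoeff, riccatiRHS_one, pow_zero, Matrix.one_mul, Matrix.sub_mul]
        abel
      rw [h1, pd_matrix_sub (f := fun t => S + (L - φ t * Q) * φ t) (hS.add (hA.matrix_mul hφ))
        (hφ.matrix_mul hR) _ ht,
        pd_matrix_add hS (hA.matrix_mul hφ) _ ht, pd_matrix_mul hA hφ _ ht,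
        pd_matrix_mul hφ hR _ ht, pd_matrix_const, pd_matrix_const, hpdA, hpd]
      simp only [Matrix.mul_zero, Matrix.neg_mul, Matrix.mul_add, Matrix.mul_assoc, ← hX, ← hAdef]
      abel
    -- For `j < k` the coefficient has index at least `2`, so it equals `A` times its predecessor.
    have hstep : ∀ j ∈ Finset.range k,
        pd (Nat.succPNat j) (riccatiCoeff S L R Q φ (k + 1 - j)) t
          = A * pd (Nat.succPNat j) (riccatiCoeff S L R Q φ (k - j)) t
            - riccatiRHS (fromBlocks R Q S L) (j + 1) X * Q *
              A ^ (k - 1 - j) * riccatiRHS (fromBlocks R Q S L) 1 X := by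
      intro j hj
      obtain ⟨i, rfl⟩ := Nat.exists_eq_add_of_lt (Finset.mem_range.1 hj)
      rw [show j + i + 1 + 1 - j = i + 2 by omega, show j + i + 1 - j = i + 1 by omega,
        show j + i + 1 - 1 - j = i by omega, riccatiCoeff_add_two,
        pd_matrix_mul hA (smoothOn_riccatiCoeff hφ _) _ ht, hpdA, riccatiCoeff]
      simp only [Matrix.neg_mul, Matrix.mul_assoc, ← hX, ← hAdef]
      abel
    rw [Finset.sum_range_succ] at ih ⊢
    rw [Finset.sum_range_succ, Finset.sum_congr rfl hstep, Finset.sum_sub_distrib,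
      ← Matrix.mul_sum]
    simp only [Nat.sub_self, Nat.add_sub_cancel_left] at ih ⊢
    rw [riccatiCoeff, hpd] at ih
    -- The last summand `ρ_{k+2}` is expanded; as `ρ_0 = 0`, its inner sum starts at `ρ_1` and
    -- matches the corrections in `hstep`.
    rw [hB, riccatiCoeff, hpd, riccatiRHS_succ _ _ _ _ (k + 1), riccati_block_eq_sum, Finset.sum_range_succ',
      riccatiRHS_zero]
    have ih' := congrArg (A * ·) ih
    simp only [Matrix.mul_add, Matrix.mul_smul] at ih'
    rw [riccatiCoeff, ← Matrix.mul_assoc, ← pow_succ'] at ih'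
    have e : ∀ j, k + 1 - 1 - (j + 1) = k - 1 - j := fun j => by omega
    simp only [e, Matrix.zero_mul, add_zero, Matrix.add_mul, Matrix.sum_mul] at ih' ⊢
    rw [riccatiCoeff]
    push_cast
    rw [add_smul _ (1 : ℝ), one_smul, ← ih']
    simp only [← hX, ← hAdef]
    abel

theorem shiftCoeff_riccati (h : IsRiccatiSolution (fromBlocks R Q S L) U φ) (k : ℕ) :
    Set.EqOn (shiftCoeff φ k) (riccatiCoeff S L R Q φ k) U := by
  induction k using Nat.strong_induction_on with
  | _ k ih =>
    cases k with
    | zero => intro t _; exact congrFun (shiftCoeff_zero φ) t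
    | succ k =>
      intro t ht
      rw [congrFun (shiftCoeff_succ φ k) t, Pi.smul_apply, Finset.sum_apply,
        Finset.sum_congr rfl fun j _ => pd_matrix_congr h.1 (ih (k - j) (by omega)) _ ht,
        sum_pd_riccatiCoeff h k ht, inv_smul_smul₀ (by positivity)]

/-- Every solution of the matrix Riccati hierarchy solves the matrix pKP hierarchy. -/
theorem IsRiccatiSolution.isPKPSolution (h : IsRiccatiSolution (fromBlocks R Q S L) U φ) :
    IsPKPSolution (qMul Q) U φ := by
  have hφ := h.2.1
  refine isPKPSolution_matrix_of_shiftCoeff (ψ := fun t => S - φ t * R) (by simp [qMul]) h.1 hφ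
    ((smoothOn_const U S).sub (hφ.matrix_mul (smoothOn_const U R))) L ?_
  -- For `k ≥ 1` the identity is `c_{k+1} = (L - φ Q) c_k`; for `k = 0` the inhomogeneous part `S -
  -- φ R` of `ρ_1` remains.
  intro k t ht
  rw [shiftCoeff_riccati h _ ht, shiftCoeff_riccati h _ ht, qMul]
  cases k with
  | zero =>
    simp only [riccatiCoeff, riccatiRHS_one, pow_zero, Matrix.one_mul, if_true]
    abel
  | succ k =>
    simp only [riccatiCoeff_add_two, Matrix.sub_mul]
    simp

end Riccati

/-! ### Inverses and blocks of matrix-valued functions. -/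

section MatrixInv

variable {n : Type*} [Fintype n] [DecidableEq n]

theorem SmoothOn.matrix_inv {U : Set Times} {f : Times → Matrix n n ℂ} (hf : SmoothOn U f)
    (h : ∀ t ∈ U, IsUnit (f t)) : SmoothOn U (fun t => (f t)⁻¹) := by
  open scoped Matrix.Norms.Operator in
  have hf' := smoothOn_iff.1 hf
  refine smoothOn_iff.2 fun t ht N => ?_
  obtain ⟨u, hu⟩ := h t ht
  have h1 : ContDiffAt ℝ ∞ Ring.inverse (f (t + incl (0 : Fin N → ℝ))) := by
    rw [incl_zero, add_zero, ← hu]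
    exact contDiffAt_ringInverse ℝ u
  refine (h1.comp (0 : Fin N → ℝ) (hf' t ht N)).congr_of_eventuallyEq
    (Filter.Eventually.of_forall fun s => ?_)
  exact nonsing_inv_eq_ringInverse _

end MatrixInv

section Rows

variable {m n : Type*} [Fintype m] [Fintype n]

/-- Writing block extraction as multiplication by a constant matrix makes the product rule cover it.
-/
theorem fromCols_one_zero_mul [DecidableEq n] (Z : Matrix (n ⊕ m) n ℂ) :
    fromCols (1 : Matrix n n ℂ) (0 : Matrix n m ℂ) * Z = Z.toRows₁ := by
  conv_lhs => rw [← fromRows_toRows Z]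
  rw [fromCols_mul_fromRows]
  simp

theorem fromCols_zero_one_mul [DecidableEq m] (Z : Matrix (n ⊕ m) n ℂ) :
    fromCols (0 : Matrix m n ℂ) (1 : Matrix m m ℂ) * Z = Z.toRows₂ := by
  conv_lhs => rw [← fromRows_toRows Z]
  rw [fromCols_mul_fromRows]
  simp

theorem toRows₁_mul_eq (A : Matrix (n ⊕ m) (n ⊕ m) ℂ) (Z : Matrix (n ⊕ m) n ℂ) :
    (A * Z).toRows₁ = A.toBlocks₁₁ * Z.toRows₁ + A.toBlocks₁₂ * Z.toRows₂ := by
  ext i j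
  simp [mul_apply, toBlocks₁₁, toBlocks₁₂]

theorem toRows₂_mul_eq (A : Matrix (n ⊕ m) (n ⊕ m) ℂ) (Z : Matrix (n ⊕ m) n ℂ) :
    (A * Z).toRows₂ = A.toBlocks₂₁ * Z.toRows₁ + A.toBlocks₂₂ * Z.toRows₂ := by
  ext i j
  simp [mul_apply, toBlocks₂₁, toBlocks₂₂]

theorem hasSum_mul_mul {ι p : Type*} [Fintype p] {f : ι → Matrix p p ℂ} {x : Matrix p p ℂ} (hf : HasSum f x)
    {a b : Type*} (V : Matrix a p ℂ) (W : Matrix p b ℂ) :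
    HasSum (fun i => V * f i * W) (V * x * W) :=
  hf.map (AddMonoidHom.mk' (fun A : Matrix p p ℂ => V * A * W) fun A B => by
    rw [Matrix.mul_add, Matrix.add_mul])
    ((continuous_const.matrix_mul continuous_id).matrix_mul continuous_const)

theorem SmoothOn.toRows₁ [DecidableEq n] {U : Set Times} {Z : Times → Matrix (n ⊕ m) n ℂ} (hZ : SmoothOn U Z) :
    SmoothOn U (fun t => (Z t).toRows₁) := by
  simp only [← fromCols_one_zero_mul]
  exact (smoothOn_const U _).matrix_mul hZ

theorem SmoothOn.toRows₂ [DecidableEq m] {U : Set Times} {Z : Times → Matrix (n ⊕ m) n ℂ} (hZ : SmoothOn U Z) :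
    SmoothOn U (fun t => (Z t).toRows₂) := by
  simp only [← fromCols_zero_one_mul]
  exact (smoothOn_const U _).matrix_mul hZ

theorem pd_toRows₁ [DecidableEq n] {U : Set Times} {Z : Times → Matrix (n ⊕ m) n ℂ} (hZ : SmoothOn U Z) (k : ℕ+)
    {t : Times} (ht : t ∈ U) : pd k (fun t => (Z t).toRows₁) t = (pd k Z t).toRows₁ := by
  simp only [← fromCols_one_zero_mul]
  rw [pd_matrix_mul (smoothOn_const U _) hZ k ht, pd_matrix_const, Matrix.zero_mul, zero_add]

theorem pd_toRows₂ [DecidableEq m] {U : Set Times} {Z : Times → Matrix (n ⊕ m) n ℂ} (hZ : SmoothOn U Z) (k : ℕ+)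
    {t : Times} (ht : t ∈ U) : pd k (fun t => (Z t).toRows₂) t = (pd k Z t).toRows₂ := by
  simp only [← fromCols_zero_one_mul]
  rw [pd_matrix_mul (smoothOn_const U _) hZ k ht, pd_matrix_const, Matrix.zero_mul, zero_add]

end Rows

/-! ### Linearization of the Riccati hierarchy. -/

section Linear

variable {m n : Type*} [Fintype m] [DecidableEq m] [Fintype n] [DecidableEq n]

/-- A solution of the linear system with invertible upper block yields a solution of the Riccati
hierarchy. -/
theorem IsLinearSolution.isRiccatiSolution {H : Matrix (n ⊕ m) (n ⊕ m) ℂ} {U : Set Times}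
    {Z : Times → Matrix (n ⊕ m) n ℂ} (h : IsLinearSolution H U Z)
    (hX : ∀ t ∈ U, IsUnit (Z t).toRows₁) : IsRiccatiSolution H U (ratio Z) := by
  obtain ⟨hU, hZ, heq⟩ := h
  have hφ : SmoothOn U (ratio Z) := hZ.toRows₂.matrix_mul (hZ.toRows₁.matrix_inv hX)
  refine ⟨hU, hφ, fun k t ht => ?_⟩
  have hdet : ∀ t ∈ U, IsUnit (Z t).toRows₁.det := fun t ht =>
    (isUnit_iff_isUnit_det _).1 (hX t ht)
  -- Differentiating `φ X = Y` avoids a formula for the derivative of `X⁻¹`.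
  have hprod : Set.EqOn (fun t => ratio Z t * (Z t).toRows₁) (fun t => (Z t).toRows₂) U := by
    intro t ht
    simp only [ratio]
    rw [nonsing_inv_mul_cancel_right _ _ (hdet t ht)]
  have h1 := pd_matrix_congr hU hprod k ht
  rw [pd_matrix_mul hφ hZ.toRows₁ k ht, pd_toRows₁ hZ k ht, pd_toRows₂ hZ k ht, heq k t ht,
    toRows₁_mul_eq, toRows₂_mul_eq,
    show (Z t).toRows₂ = ratio Z t * (Z t).toRows₁ from (hprod ht).symm] at h1
  have h2 := congrArg (· * (Z t).toRows₁⁻¹) (eq_sub_of_add_eq h1)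
  simp only [Matrix.sub_mul, Matrix.add_mul, Matrix.mul_add, ← Matrix.mul_assoc,
    mul_nonsing_inv_cancel_right _ _ (hdet t ht)] at h2
  rw [h2]
  abel

end Linear

/-! ### The series `ξ(A)` and its exponential. -/

section Xi

variable {p q : Type*} [Fintype p] [DecidableEq p] [Fintype q] [DecidableEq q]

theorem hasSum_xi_incl (A : Matrix p p ℂ) {N : ℕ} (s : Fin N → ℝ) :
    HasSum (fun k : ℕ+ => incl s k • A ^ (k : ℕ)) (∑ i : Fin N, s i • A ^ ((i : ℕ) + 1)) := by
  have h : ∀ i : Fin N, HasSum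
      (fun k : ℕ+ => (Pi.single (Nat.succPNat (i : ℕ)) (s i) : Times) k • A ^ (k : ℕ))
      (s i • A ^ ((i : ℕ) + 1)) := by
    intro i
    have := hasSum_single (f := fun k : ℕ+ =>
      (Pi.single (Nat.succPNat (i : ℕ)) (s i) : Times) k • A ^ (k : ℕ)) (Nat.succPNat (i : ℕ))
      fun k hk => by rw [Pi.single_eq_of_ne hk, zero_smul]
    simpa using this
  have := hasSum_sum fun i (_ : i ∈ Finset.univ) => h i
  simpa only [incl, Finset.sum_apply, Finset.sum_smul] using this

theorem add_incl_mem_xiDomain {A : Matrix p p ℂ} {t : Times} (ht : t ∈ xiDomain A) {N : ℕ}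
    (s : Fin N → ℝ) : t + incl s ∈ xiDomain A := by
  have := Summable.add ht (hasSum_xi_incl A s).summable
  simpa only [xiDomain, Set.mem_ofPred_eq, Pi.add_apply, add_smul] using this

theorem xi_add_incl {A : Matrix p p ℂ} {t : Times} (ht : t ∈ xiDomain A) {N : ℕ}
    (s : Fin N → ℝ) : xi A (t + incl s) = xi A t + ∑ i : Fin N, s i • A ^ ((i : ℕ) + 1) := by
  have := Summable.tsum_add ht (hasSum_xi_incl A s).summable
  rw [(hasSum_xi_incl A s).tsum_eq] at this
  simpa only [xi, Pi.add_apply, add_smul] using this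

theorem isFinOpen_xiDomain (A : Matrix p p ℂ) : IsFinOpen (xiDomain A) :=
  fun _ ht _ => Filter.Eventually.of_forall fun s => add_incl_mem_xiDomain ht s

/-- The relation `W A = B W` passes to powers, and by convergence to `ξ` and `exp`. Rectangular `W`
is allowed, as the block-triangular case requires. -/
theorem intertwine_pow {A : Matrix p p ℂ} {B : Matrix q q ℂ} {W : Matrix q p ℂ}
    (h : W * A = B * W) (k : ℕ) : W * A ^ k = B ^ k * W := by
  induction k with
  | zero => simp
  | succ k ih => rw [pow_succ, ← Matrix.mul_assoc, ih, Matrix.mul_assoc, h, ← Matrix.mul_assoc,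
      ← pow_succ]

theorem intertwine_xi {A : Matrix p p ℂ} {B : Matrix q q ℂ} {W : Matrix q p ℂ}
    (h : W * A = B * W) {t : Times} (hA : t ∈ xiDomain A) (hB : t ∈ xiDomain B) :
    W * xi A t = xi B t * W := by
  have h1 := hasSum_mul_mul (Summable.hasSum hA) W (1 : Matrix p p ℂ)
  have h2 := hasSum_mul_mul (Summable.hasSum hB) (1 : Matrix q q ℂ) W
  simp only [Matrix.mul_one, Matrix.one_mul, Matrix.mul_smul, Matrix.smul_mul,
    intertwine_pow h] at h1 h2
  exact h1.unique h2

theorem hasSum_matrix_exp (A : Matrix p p ℂ) :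
    HasSum (fun k : ℕ => ((k.factorial : ℝ)⁻¹) • A ^ k) (NormedSpace.exp A) :=
  open scoped Matrix.Norms.Operator in
  NormedSpace.exp_series_hasSum_exp' (𝕂 := ℝ) A

theorem intertwine_exp {A : Matrix p p ℂ} {B : Matrix q q ℂ} {W : Matrix q p ℂ}
    (h : W * A = B * W) : W * NormedSpace.exp A = NormedSpace.exp B * W := by
  have h1 := hasSum_mul_mul (hasSum_matrix_exp A) W (1 : Matrix p p ℂ)
  have h2 := hasSum_mul_mul (hasSum_matrix_exp B) (1 : Matrix q q ℂ) W
  simp only [Matrix.mul_one, Matrix.one_mul, Matrix.mul_smul, Matrix.smul_mul,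
    intertwine_pow h] at h1 h2
  exact h1.unique h2

theorem commute_pow_xi {A : Matrix p p ℂ} {t : Times} (ht : t ∈ xiDomain A) (k : ℕ) :
    Commute (A ^ k) (xi A t) :=
  intertwine_xi ((Commute.refl A).pow_left k) ht ht

theorem contDiff_matrix_exp_sum (A : Matrix p p ℂ) (c : ℝ) (N : ℕ) (B : Matrix p p ℂ)
    (l : Matrix p p ℂ →L[ℝ] ℝ) :
    ContDiff ℝ ∞ (fun s : Fin N → ℝ =>
      l (NormedSpace.exp (c • ∑ i : Fin N, s i • A ^ ((i : ℕ) + 1)) * B)) := by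
  open scoped Matrix.Norms.Operator in
  have h1 : ContDiff ℝ ∞ (NormedSpace.exp : Matrix p p ℂ → Matrix p p ℂ) :=
    contDiff_iff_contDiffAt.2 fun x => (NormedSpace.exp_analytic (𝕂 := ℝ) x).contDiffAt
  have h2 : ContDiff ℝ ∞ (fun s : Fin N → ℝ => c • ∑ i : Fin N, s i • A ^ ((i : ℕ) + 1)) := by
    fun_prop
  exact l.contDiff.comp ((h1.comp h2).mul contDiff_const)

/-- The finite increment commutes with `ξ(A)`. The scalar `c` serves `e^{ξ}` and `e^{-ξ}` at once.
-/
theorem exp_xi_add_incl {A : Matrix p p ℂ} {t : Times} (ht : t ∈ xiDomain A) (c : ℝ) {N : ℕ}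
    (s : Fin N → ℝ) : NormedSpace.exp (c • xi A (t + incl s))
      = NormedSpace.exp (c • ∑ i : Fin N, s i • A ^ ((i : ℕ) + 1))
        * NormedSpace.exp (c • xi A t) := by
  rw [xi_add_incl ht, add_comm, smul_add, Matrix.exp_add_of_commute]
  refine Commute.smul_left (Commute.smul_right (Commute.sum_left _ _ _ fun i _ => ?_) _) _
  exact (commute_pow_xi ht _).smul_left _

theorem smoothOn_exp_xi (A : Matrix p p ℂ) (c : ℝ) :
    SmoothOn (xiDomain A) (fun t => NormedSpace.exp (c • xi A t)) := by
  intro t ht N l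
  simp only [exp_xi_add_incl ht]
  exact (contDiff_matrix_exp_sum A c N _ l).contDiffAt

theorem hasDerivAt_matrix_exp_smul (A : Matrix p p ℂ) :
    HasDerivAt (fun s : ℝ => NormedSpace.exp (s • A)) A 0 := by
  open scoped Matrix.Norms.Operator in
  have h := hasDerivAt_exp_smul_const (𝕂 := ℝ) A 0
  simp only [zero_smul, NormedSpace.exp_zero, one_mul] at h
  exact h

theorem deriv_matrix_mul_const {f : ℝ → Matrix p p ℂ} {f' : Matrix p p ℂ} {x : ℝ}
    (h : HasDerivAt f f' x) (B : Matrix p p ℂ) : deriv (fun s => f s * B) x = f' * B :=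
  open scoped Matrix.Norms.Operator in
  (HasDerivAt.mul_const h B).deriv

theorem pd_exp_xi {A : Matrix p p ℂ} {t : Times} (ht : t ∈ xiDomain A) (c : ℝ) (k : ℕ+) :
    pd k (fun t => NormedSpace.exp (c • xi A t)) t
      = (c • A ^ (k : ℕ)) * NormedSpace.exp (c • xi A t) := by
  have h : ∀ s : ℝ, NormedSpace.exp (c • xi A (t + Pi.single k s))
      = NormedSpace.exp (s • (c • A ^ (k : ℕ))) * NormedSpace.exp (c • xi A t) := by
    intro s
    have h1 := exp_xi_add_incl ht c (Pi.single (Fin.last k.natPred) s)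
    rw [incl_single, Finset.sum_eq_single (Fin.last k.natPred)] at h1
    · rw [smul_comm s c]
      simpa using h1
    · intro i _ hi
      simp [Pi.single_eq_of_ne hi]
    · simp
  simp only [pd, h]
  exact deriv_matrix_mul_const (hasDerivAt_matrix_exp_smul _) _

end Xi

/-! ### Exponential solutions and their domain. -/

section ExpSolution

variable {m n : Type*} [Fintype m] [DecidableEq m] [Fintype n] [DecidableEq n]

theorem isLinearSolution_expSolution (H : Matrix (n ⊕ m) (n ⊕ m) ℂ) (Z₀ : Matrix (n ⊕ m) n ℂ) :
    IsLinearSolution H (xiDomain H) (expSolution H Z₀) := by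
  have h1 := smoothOn_exp_xi H 1
  have h2 := smoothOn_const (xiDomain H) Z₀
  have h3 := fun (k : ℕ+) (t : Times) (ht : t ∈ xiDomain H) => pd_exp_xi ht 1 k
  simp only [one_smul] at h1 h3
  refine ⟨isFinOpen_xiDomain H, h1.matrix_mul h2, fun k t ht => ?_⟩
  rw [expSolution, ← Matrix.mul_assoc, ← h3 k t ht]
  refine (pd_matrix_mul h1 h2 k ht).trans ?_
  rw [pd_matrix_const, Matrix.mul_zero, add_zero]

theorem SmoothOn.isFinOpen_isUnit {U : Set Times} (hU : IsFinOpen U) {f : Times → Matrix n n ℂ}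
    (hf : SmoothOn U f) : IsFinOpen {t | t ∈ U ∧ IsUnit (f t)} := by
  open scoped Matrix.Norms.Operator in
  rintro t ⟨ht, hu⟩ N
  have hc := (smoothOn_iff.1 hf t ht N).continuousAt
  have hopen := Units.isOpen.mem_nhds (x := f (t + incl (0 : Fin N → ℝ))) (by simpa using hu)
  filter_upwards [hU t ht N, hc hopen] with s hs1 hs2
  exact ⟨hs1, hs2⟩

theorem isFinOpen_regularDomain (H : Matrix (n ⊕ m) (n ⊕ m) ℂ) (Z₀ : Matrix (n ⊕ m) n ℂ) :
    IsFinOpen (regularDomain H Z₀) :=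
  (isLinearSolution_expSolution H Z₀).2.1.toRows₁.isFinOpen_isUnit (isFinOpen_xiDomain H)

theorem IsLinearSolution.mono {H : Matrix (n ⊕ m) (n ⊕ m) ℂ} {U U' : Set Times}
    {Z : Times → Matrix (n ⊕ m) n ℂ} (h : IsLinearSolution H U Z) (hU' : IsFinOpen U')
    (hs : U' ⊆ U) : IsLinearSolution H U' Z :=
  ⟨hU', h.2.1.mono hs, fun k t ht => h.2.2 k t (hs ht)⟩

theorem isRiccatiSolution_expSolution (H : Matrix (n ⊕ m) (n ⊕ m) ℂ)
    (Z₀ : Matrix (n ⊕ m) n ℂ) :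
    IsRiccatiSolution H (regularDomain H Z₀) (ratio (expSolution H Z₀)) :=
  ((isLinearSolution_expSolution H Z₀).mono (isFinOpen_regularDomain H Z₀)
    fun _ ht => ht.1).isRiccatiSolution fun _ ht => ht.2

end ExpSolution

/-! ### Rank one and the trace homomorphism. -/

section RankOne

variable {m n : Type*} [Fintype m] [Fintype n]

/-- The column space is a line: `u` spans it and `v` lists the coefficients of the columns. -/
theorem exists_eq_vecMulVec_of_rank_eq_one {Q : Matrix n m ℂ} (hQ : Q.rank = 1) :
    ∃ u v, Q = vecMulVec u v := by
  rw [rank_eq_finrank_span_cols, finrank_eq_one_iff'] at hQ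
  obtain ⟨u, _, hu⟩ := hQ
  choose v hv using fun j => hu ⟨Q.col j, Submodule.subset_span ⟨j, rfl⟩⟩
  refine ⟨u, v, ?_⟩
  ext i j
  have := congrFun (congrArg Subtype.val (hv j)) i
  simp only [Submodule.coe_smul, Pi.smul_apply, smul_eq_mul, col_apply] at this
  rw [vecMulVec_apply, ← this, mul_comm]

theorem trace_mul_qMul {Q : Matrix n m ℂ} (hQ : Q.rank = 1) (A B : Matrix m n ℂ) :
    (Q * qMul Q A B).trace = (Q * A).trace * (Q * B).trace := by
  obtain ⟨u, v, rfl⟩ := exists_eq_vecMulVec_of_rank_eq_one hQ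
  rw [qMul, ← Matrix.mul_assoc, ← Matrix.mul_assoc, vecMulVec_mul, vecMulVec_mul_vecMulVec]
  simp only [vecMulVec_mul, trace_vecMulVec, smul_vecMul, dotProduct_smul, smul_eq_mul]
  rw [dotProduct_comm u (v ᵥ* A)]

/-- The real linear map `A ↦ tr (Q A)`. -/
noncomputable def traceMulCLM (Q : Matrix n m ℂ) : Matrix m n ℂ →L[ℝ] ℂ :=
  LinearMap.toContinuousLinearMap
    { toFun := fun A => (Q * A).trace
      map_add' := fun A B => by rw [Matrix.mul_add, trace_add]
      map_smul' := fun r A => by rw [Matrix.mul_smul, trace_smul]; rfl }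

theorem isLinearMap_trace_mul (Q : Matrix n m ℂ) :
    IsLinearMap ℂ (fun A : Matrix m n ℂ => (Q * A).trace) :=
  ⟨fun A B => by rw [Matrix.mul_add, trace_add], fun c A => by rw [Matrix.mul_smul, trace_smul]⟩

theorem SmoothOn.trace_mul {U : Set Times} {φ : Times → Matrix m n ℂ} (hφ : SmoothOn U φ)
    (Q : Matrix n m ℂ) : SmoothOn U (fun t => (Q * φ t).trace) :=
  hφ.clm (traceMulCLM Q)

theorem IsPKPSolution.trace_mul {Q : Matrix n m ℂ} (hQ : Q.rank = 1) {U : Set Times}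
    {φ : Times → Matrix m n ℂ} (h : IsPKPSolution (qMul Q) U φ) :
    IsPKPSolution (fun a b : ℂ => a * b) U (fun t => (Q * φ t).trace) :=
  h.map_matrix (traceMulCLM Q) (trace_mul_qMul hQ)
    fun U _ _ hf hg => (hf.matrix_mul (smoothOn_const U Q)).matrix_mul hg

end RankOne

theorem SmoothOn.matrix_hasDerivAt {n : Type*} [Fintype n] {U : Set Times} {f : Times → Matrix n n ℂ} (hf : SmoothOn U f)
    {t : Times} (ht : t ∈ U) (k : ℕ+) : HasDerivAt (fun r : ℝ => f (t + Pi.single k r)) (RiccatiKP.pd k f t) 0 :=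
  open scoped Matrix.Norms.Operator in
  hf.hasDerivAt ht k

/-! ### Jacobi's formula and logarithmic derivatives. -/

section Jacobi

variable {n : Type*} [Fintype n] [DecidableEq n]

/-- The determinant is `1 + z tr M + z² p(z)` with a polynomial `p`. -/
theorem hasDerivAt_det_one_add_smul (M : Matrix n n ℂ) :
    HasDerivAt (fun s : ℝ => (1 + (s : ℂ) • M).det) M.trace 0 := by
  have h : HasDerivAt (fun z : ℂ => (1 + z • M).det) M.trace ((0 : ℝ) : ℂ) := by
    rw [funext fun z : ℂ => det_one_add_smul z M]
    have h1 := ((hasDerivAt_id ((0 : ℝ) : ℂ)).const_mul M.trace).const_add 1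
    have h2 := (Polynomial.hasDerivAt
      (det (1 + (Polynomial.X : Polynomial ℂ) • M.map Polynomial.C)).divX.divX
        ((0 : ℝ) : ℂ)).mul (hasDerivAt_pow 2 ((0 : ℝ) : ℂ))
    exact (h1.add h2).congr_deriv (by simp)
  exact h.comp_ofReal

theorem differentiable_matrix_det :
    letI := Matrix.linftyOpNormedAddCommGroup (m := n) (n := n) (α := ℂ)
    letI := Matrix.linftyOpNormedSpace (m := n) (n := n) (R := ℝ) (α := ℂ)
    Differentiable ℝ (fun A : Matrix n n ℂ => A.det) := by
  open scoped Matrix.Norms.Operator in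
  intro A
  have hentry : ∀ i j : n, DifferentiableAt ℝ (fun A : Matrix n n ℂ => A i j) A := fun i j =>
    (LinearMap.toContinuousLinearMap (entryLinearMap ℝ ℂ i j)).differentiableAt
  have hprod : ∀ σ : Equiv.Perm n,
      DifferentiableAt ℝ (fun A : Matrix n n ℂ => ∏ i, A (σ i) i) A := fun σ =>
    (HasFDerivAt.finsetProd fun i _ => (hentry (σ i) i).hasFDerivAt).differentiableAt
  simp only [det_apply']
  exact DifferentiableAt.fun_sum fun σ _ => (differentiableAt_const _).mul (hprod σ)

/-- Jacobi's formula at an invertible matrix. -/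
theorem hasDerivAt_matrix_det {T : ℝ → Matrix n n ℂ} {T' : Matrix n n ℂ} {x : ℝ}
    (hT : HasDerivAt T T' x) (hu : IsUnit (T x).det) :
    HasDerivAt (fun s => (T s).det) ((T x).det * ((T x)⁻¹ * T').trace) x := by
  open scoped Matrix.Norms.Operator in
  have hd := (differentiable_matrix_det (T x)).hasFDerivAt
  have h1 := hd.comp_hasDerivAt x hT
  -- By the chain rule only the derivative of `det` at `T x` in direction `T'` matters; it is
  -- computed along a straight line and identified by uniqueness.
  have hline : HasDerivAt (fun s : ℝ => T x + s • T') T' 0 := by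
    have := ((hasDerivAt_id (0 : ℝ)).smul_const T').const_add (T x)
    rwa [one_smul] at this
  have hd' := (differentiable_matrix_det (T x + (0 : ℝ) • T')).hasFDerivAt
  have h2 := hd'.comp_hasDerivAt (0 : ℝ) hline
  have h3 : HasDerivAt (fun s : ℝ => (T x + s • T').det) ((T x).det * ((T x)⁻¹ * T').trace) 0 := by
    have := (hasDerivAt_det_one_add_smul ((T x)⁻¹ * T')).const_mul (T x).det
    refine this.congr_of_eventuallyEq (Filter.Eventually.of_forall fun s => ?_)
    show (T x + s • T').det = (T x).det * (1 + (s : ℂ) • ((T x)⁻¹ * T')).det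
    rw [← det_mul, Matrix.mul_add, Matrix.mul_one, Matrix.mul_smul,
      mul_nonsing_inv_cancel_left _ _ hu, Complex.coe_smul]
  have h4 := h2.unique h3
  simp only [zero_smul, add_zero] at h4
  rw [← h4]
  exact h1

/-- Normalizing by `τ t` places the value at `s = 0` at `1`, away from the cut of the principal
logarithm; the constant `log (τ t)` restores `τ`. -/
theorem hasLogPartialDeriv_of_hasDerivAt {k : ℕ+} {τ : Times → ℂ} {t : Times} {v : ℂ}
    (h : HasDerivAt (fun s : ℝ => τ (t + Pi.single k s)) (τ t * v) 0) (ht : τ t ≠ 0) :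
    HasLogPartialDeriv k τ v t := by
  have h1 : HasDerivAt (fun s : ℝ => τ (t + Pi.single k s) / τ t) v 0 := by
    have := h.div_const (τ t)
    rwa [mul_div_cancel_left₀ _ ht] at this
  have h0 : τ (t + Pi.single k 0) / τ t = 1 := by simp [ht]
  refine ⟨fun s => Complex.log (τ (t + Pi.single k s) / τ t) + Complex.log (τ t), ?_, ?_⟩
  · have hne := h1.continuousAt.eventually_ne (y := 0) (by rw [h0]; exact one_ne_zero)
    filter_upwards [hne] with s hs
    rw [Complex.exp_add, Complex.exp_log hs, Complex.exp_log ht, div_mul_cancel₀ _ ht]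
  · have h2 := h1.clog_real (by rw [h0]; exact Complex.one_mem_slitPlane)
    rw [h0, div_one] at h2
    exact h2.add_const _

end Jacobi

/-! ### The block-triangular case and the tau function. -/

section Intertwine

variable {m n : Type*} [Fintype m] [Fintype n]

theorem fromCols_zero_one_intertwine [DecidableEq m] (L : Matrix m m ℂ)
    (R : Matrix n n ℂ) (Q : Matrix n m ℂ) :
    fromCols (0 : Matrix m n ℂ) (1 : Matrix m m ℂ) * fromBlocks R Q 0 L
      = L * fromCols (0 : Matrix m n ℂ) (1 : Matrix m m ℂ) := by
  rw [fromCols_mul_fromBlocks, mul_fromCols]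
  simp

/-- This is where `Q = R K - K L` enters: `Q + K L = R K`. -/
theorem fromCols_one_intertwine [DecidableEq n] (L : Matrix m m ℂ) (R : Matrix n n ℂ)
    (K : Matrix n m ℂ) :
    fromCols (1 : Matrix n n ℂ) K * fromBlocks R (R * K - K * L) 0 L
      = R * fromCols (1 : Matrix n n ℂ) K := by
  rw [fromCols_mul_fromBlocks, mul_fromCols]
  simp

end Intertwine

section BlockTriangular

variable {m n : Type*} [Fintype m] [DecidableEq m] [Fintype n] [DecidableEq n]
variable (L : Matrix m m ℂ) (R : Matrix n n ℂ) (K : Matrix n m ℂ)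

/-- The rows `(1 K)` and `(0 1)` together form an invertible matrix conjugating `H` to `diag(R, L)`.
-/
theorem xiDomain_blockTriangular :
    xiDomain (fromBlocks R (R * K - K * L) 0 L) = xiDomain R ∩ xiDomain L := by
  set H := fromBlocks R (R * K - K * L) 0 L
  have hL : ∀ k, fromCols (0 : Matrix m n ℂ) (1 : Matrix m m ℂ) * H ^ k
      = L ^ k * fromCols (0 : Matrix m n ℂ) (1 : Matrix m m ℂ) :=
    intertwine_pow (fromCols_zero_one_intertwine L R (R * K - K * L))
  have hR : ∀ k, fromCols (1 : Matrix n n ℂ) K * H ^ k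
      = R ^ k * fromCols (1 : Matrix n n ℂ) K :=
    intertwine_pow (fromCols_one_intertwine L R K)
  ext t
  constructor
  · intro ht
    constructor
    · have h := (hasSum_mul_mul (Summable.hasSum ht) (fromCols (1 : Matrix n n ℂ) K)
        (fromRows (1 : Matrix n n ℂ) (0 : Matrix m n ℂ))).summable
      simp only [Matrix.mul_smul, Matrix.smul_mul, hR] at h
      simpa only [Matrix.mul_assoc, fromCols_mul_fromRows, Matrix.mul_one, Matrix.mul_zero,
        add_zero, xiDomain, Set.mem_ofPred_eq] using h
    · have h := (hasSum_mul_mul (Summable.hasSum ht)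
        (fromCols (0 : Matrix m n ℂ) (1 : Matrix m m ℂ))
        (fromRows (0 : Matrix n m ℂ) (1 : Matrix m m ℂ))).summable
      simp only [Matrix.mul_smul, Matrix.smul_mul, hL] at h
      simpa only [Matrix.mul_assoc, fromCols_mul_fromRows, Matrix.mul_one, Matrix.mul_zero,
        zero_add, xiDomain, Set.mem_ofPred_eq] using h
  · rintro ⟨h1, h2⟩
    have h1' := (hasSum_mul_mul (Summable.hasSum h1)
      (fromRows (1 : Matrix n n ℂ) (0 : Matrix m n ℂ)) (fromCols (1 : Matrix n n ℂ) K)).summable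
    have h2' := (hasSum_mul_mul (Summable.hasSum h2)
      (fromRows (-K) (1 : Matrix m m ℂ))
      (fromCols (0 : Matrix m n ℂ) (1 : Matrix m m ℂ))).summable
    -- Resolution of the identity by the two intertwiners; it reassembles `H^k` from `R^k` and
    -- `L^k`.
    have hone : fromRows (1 : Matrix n n ℂ) (0 : Matrix m n ℂ) * fromCols (1 : Matrix n n ℂ) K
        + fromRows (-K) (1 : Matrix m m ℂ) * fromCols (0 : Matrix m n ℂ) (1 : Matrix m m ℂ)
        = 1 := by
      rw [fromRows_mul_fromCols, fromRows_mul_fromCols, fromBlocks_add, ← fromBlocks_one]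
      simp
    refine (h1'.add h2').congr fun k => ?_
    rw [Matrix.mul_smul, Matrix.smul_mul, Matrix.mul_smul, Matrix.smul_mul, ← smul_add,
      Matrix.mul_assoc, Matrix.mul_assoc, ← hR, ← hL, ← Matrix.mul_assoc, ← Matrix.mul_assoc,
      ← Matrix.add_mul, hone, Matrix.one_mul]

variable {L R K} {X₀ : Matrix n n ℂ} {Y₀ : Matrix m n ℂ} {t : Times}

theorem expSolution_blockTriangular
    (ht : t ∈ xiDomain (fromBlocks R (R * K - K * L) 0 L)) :
    (expSolution (fromBlocks R (R * K - K * L) 0 L) (fromRows X₀ Y₀) t).toRows₂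
      = NormedSpace.exp (xi L t) * Y₀ ∧
    (expSolution (fromBlocks R (R * K - K * L) 0 L) (fromRows X₀ Y₀) t).toRows₁
      = NormedSpace.exp (xi R t) * (X₀ + K * Y₀) - K * (NormedSpace.exp (xi L t) * Y₀) := by
  have hRL := (xiDomain_blockTriangular L R K).subset ht
  have h2 : (expSolution (fromBlocks R (R * K - K * L) 0 L) (fromRows X₀ Y₀) t).toRows₂
      = NormedSpace.exp (xi L t) * Y₀ := by
    rw [← fromCols_zero_one_mul, expSolution, ← Matrix.mul_assoc, intertwine_exp
      (intertwine_xi (fromCols_zero_one_intertwine L R _) ht hRL.2), Matrix.mul_assoc,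
      fromCols_mul_fromRows]
    simp
  refine ⟨h2, ?_⟩
  -- The combination `X + K Y` evolves by `e^{ξ(R)}` alone.
  have h1 : fromCols (1 : Matrix n n ℂ) K
        * expSolution (fromBlocks R (R * K - K * L) 0 L) (fromRows X₀ Y₀) t
      = NormedSpace.exp (xi R t) * (X₀ + K * Y₀) := by
    rw [expSolution, ← Matrix.mul_assoc, intertwine_exp
      (intertwine_xi (fromCols_one_intertwine L R K) ht hRL.1), Matrix.mul_assoc,
      fromCols_mul_fromRows, Matrix.one_mul]
  rw [← fromRows_toRows (expSolution _ _ t), fromCols_mul_fromRows, Matrix.one_mul, h2] at h1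
  exact eq_sub_of_add_eq h1

theorem exp_neg_mul_exp (A : Matrix n n ℂ) : NormedSpace.exp (-A) * NormedSpace.exp A = 1 := by
  rw [Matrix.exp_neg, nonsing_inv_mul _ ((isUnit_iff_isUnit_det _).1 (Matrix.isUnit_exp A))]

theorem exp_mul_exp_neg (A : Matrix n n ℂ) : NormedSpace.exp A * NormedSpace.exp (-A) = 1 :=
  mul_eq_one_comm.1 (exp_neg_mul_exp A)

theorem toRows₁_expSolution_eq (hX₀ : IsUnit X₀)
    (ht : t ∈ xiDomain (fromBlocks R (R * K - K * L) 0 L)) :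
    (expSolution (fromBlocks R (R * K - K * L) 0 L) (fromRows X₀ Y₀) t).toRows₁
      = NormedSpace.exp (xi R t) * tauMatrix R L K (Y₀ * X₀⁻¹) t * X₀ := by
  have hdet := (isUnit_iff_isUnit_det _).1 hX₀
  have h := exp_mul_exp_neg (xi R t)
  rw [(expSolution_blockTriangular ht).2, tauMatrix]
  simp only [Matrix.mul_add, Matrix.mul_sub, Matrix.add_mul, Matrix.sub_mul, Matrix.mul_assoc,
    nonsing_inv_mul _ hdet, Matrix.mul_one]
  rw [← Matrix.mul_assoc (NormedSpace.exp (xi R t)) (NormedSpace.exp (-xi R t)), h,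
    Matrix.one_mul]

theorem isUnit_toRows₁_expSolution_iff (hX₀ : IsUnit X₀)
    (ht : t ∈ xiDomain (fromBlocks R (R * K - K * L) 0 L)) :
    IsUnit (expSolution (fromBlocks R (R * K - K * L) 0 L) (fromRows X₀ Y₀) t).toRows₁
      ↔ (tauMatrix R L K (Y₀ * X₀⁻¹) t).det ≠ 0 := by
  have h1 := (isUnit_iff_isUnit_det _).1 hX₀
  have h2 := (isUnit_iff_isUnit_det _).1 (Matrix.isUnit_exp (xi R t))
  rw [toRows₁_expSolution_eq hX₀ ht, isUnit_iff_isUnit_det, det_mul, det_mul, isUnit_iff_ne_zero]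
  simp [h1.ne_zero, h2.ne_zero]

theorem ratio_expSolution_eq (hX₀ : IsUnit X₀)
    (ht : t ∈ xiDomain (fromBlocks R (R * K - K * L) 0 L)) :
    ratio (expSolution (fromBlocks R (R * K - K * L) 0 L) (fromRows X₀ Y₀)) t
      = NormedSpace.exp (xi L t) * (Y₀ * X₀⁻¹) * (tauMatrix R L K (Y₀ * X₀⁻¹) t)⁻¹
        * NormedSpace.exp (-xi R t) := by
  rw [ratio, toRows₁_expSolution_eq hX₀ ht, (expSolution_blockTriangular ht).1,
    Matrix.mul_inv_rev, Matrix.mul_inv_rev, Matrix.exp_neg]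
  simp only [Matrix.mul_assoc]

theorem zero_mem_xiDomain (A : Matrix n n ℂ) : (0 : Times) ∈ xiDomain A := by
  simp [xiDomain]

theorem zero_mem_regularDomain (H : Matrix (n ⊕ m) (n ⊕ m) ℂ) (hX₀ : IsUnit X₀) :
    (0 : Times) ∈ regularDomain H (fromRows X₀ Y₀) := by
  refine ⟨zero_mem_xiDomain H, ?_⟩
  simpa [expSolution, xi] using hX₀

theorem smoothOn_tauMatrix (R : Matrix n n ℂ) (L : Matrix m m ℂ) (K : Matrix n m ℂ)
    (φ₀ : Matrix m n ℂ) : SmoothOn (xiDomain R ∩ xiDomain L) (tauMatrix R L K φ₀) := by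
  have hR := (smoothOn_exp_xi R (-1)).mono (Set.inter_subset_left (t := xiDomain L))
  have hL := (smoothOn_exp_xi L 1).mono (Set.inter_subset_right (s := xiDomain R))
  simp only [neg_smul, one_smul] at hR hL
  exact (smoothOn_const _ (1 + K * φ₀)).sub
    (((hR.matrix_mul (smoothOn_const _ K)).matrix_mul hL).matrix_mul (smoothOn_const _ φ₀))

theorem pd_tauMatrix (φ₀ : Matrix m n ℂ) (ht : t ∈ xiDomain R ∩ xiDomain L) :
    pd 1 (tauMatrix R L K φ₀) t
      = NormedSpace.exp (-xi R t) * (R * K - K * L) * NormedSpace.exp (xi L t) * φ₀ := by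
  have hR := (smoothOn_exp_xi R (-1)).mono (Set.inter_subset_left (t := xiDomain L))
  have hL := (smoothOn_exp_xi L 1).mono (Set.inter_subset_right (s := xiDomain R))
  have hpR := pd_exp_xi ht.1 (-1) 1
  have hpL := pd_exp_xi ht.2 1 1
  simp only [neg_smul, one_smul, PNat.one_coe, pow_one] at hR hL hpR hpL
  have hK := smoothOn_const (xiDomain R ∩ xiDomain L) K
  have hφ := smoothOn_const (xiDomain R ∩ xiDomain L) φ₀
  have hRK := hR.matrix_mul hK
  have hcomm : R * NormedSpace.exp (-xi R t) = NormedSpace.exp (-xi R t) * R := by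
    have := intertwine_xi (W := R) rfl ht.1 ht.1
    exact intertwine_exp (by rw [Matrix.mul_neg, Matrix.neg_mul, this])
  have h : pd 1 (tauMatrix R L K φ₀) t = _ :=
    pd_matrix_sub (smoothOn_const _ (1 + K * φ₀)) ((hRK.matrix_mul hL).matrix_mul hφ) 1 ht
  rw [h, pd_matrix_const, pd_matrix_mul (hRK.matrix_mul hL) hφ _ ht, pd_matrix_mul hRK hL _ ht,
    pd_matrix_mul hR hK _ ht, pd_matrix_const, pd_matrix_const, hpR, hpL, Matrix.neg_mul, hcomm]
  simp only [Matrix.mul_zero, add_zero, Matrix.neg_mul, Matrix.add_mul, Matrix.mul_assoc,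
    Matrix.mul_sub, Matrix.sub_mul]
  abel

theorem hasLogPartialDeriv_det_tauMatrix (hX₀ : IsUnit X₀)
    (ht : t ∈ regularDomain (fromBlocks R (R * K - K * L) 0 L) (fromRows X₀ Y₀)) :
    HasLogPartialDeriv 1 (fun t => (tauMatrix R L K (Y₀ * X₀⁻¹) t).det)
      ((R * K - K * L) *
        ratio (expSolution (fromBlocks R (R * K - K * L) 0 L) (fromRows X₀ Y₀)) t).trace t := by
  have hne := (isUnit_toRows₁_expSolution_iff hX₀ ht.1).1 ht.2
  have hRL := (xiDomain_blockTriangular L R K).subset ht.1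
  have hT := (smoothOn_tauMatrix R L K (Y₀ * X₀⁻¹)).matrix_hasDerivAt hRL 1
  rw [pd_tauMatrix _ hRL] at hT
  have h := hasDerivAt_matrix_det hT (by simpa using hne)
  refine hasLogPartialDeriv_of_hasDerivAt ?_ hne
  simp only [Pi.single_zero, add_zero] at h
  convert h using 2
  -- Cyclicity of the trace turns `tr (T⁻¹ T_{t_1})` into `tr (Q φ)`.
  rw [ratio_expSolution_eq hX₀ ht.1, ← Matrix.mul_assoc, trace_mul_comm, ← Matrix.mul_assoc,
    ← Matrix.mul_assoc, trace_mul_comm]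
  simp only [Matrix.mul_assoc]

end BlockTriangular

end RiccatiKP

theorem mainTheorem7 {m n : Type*} [Fintype m] [DecidableEq m] [Fintype n] [DecidableEq n] :
    -- solutions of the linear system yield solutions of the Riccati hierarchy
    (∀ (H : Matrix (n ⊕ m) (n ⊕ m) ℂ) (U : Set Times) (Z : Times → Matrix (n ⊕ m) n ℂ),
      IsLinearSolution H U Z → (∀ t ∈ U, IsUnit (Z t).toRows₁) →
        IsRiccatiSolution H U (ratio Z)) ∧
    -- `e^{ξ(H)} Z₀` solves the linear system, hence yields a solution of the Riccati hierarchy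
    (∀ (H : Matrix (n ⊕ m) (n ⊕ m) ℂ) (Z₀ : Matrix (n ⊕ m) n ℂ),
      IsLinearSolution H (xiDomain H) (expSolution H Z₀) ∧
        IsRiccatiSolution H (regularDomain H Z₀) (ratio (expSolution H Z₀))) ∧
    -- every solution of the Riccati hierarchy solves the matrix pKP hierarchy
    (∀ (S : Matrix m n ℂ) (L : Matrix m m ℂ) (R : Matrix n n ℂ) (Q : Matrix n m ℂ)
      (U : Set Times) (φ : Times → Matrix m n ℂ),
      IsRiccatiSolution (Matrix.fromBlocks R Q S L) U φ → IsPKPSolution (qMul Q) U φ) ∧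
    -- the rank one condition: homomorphism into the scalars, scalar pKP solutions
    (∀ Q : Matrix n m ℂ, Q.rank = 1 →
      IsLinearMap ℂ (fun A : Matrix m n ℂ => (Q * A).trace) ∧
      (∀ A B : Matrix m n ℂ, (Q * qMul Q A B).trace = (Q * A).trace * (Q * B).trace) ∧
      (∀ (U : Set Times) (φ : Times → Matrix m n ℂ), SmoothOn U φ →
        SmoothOn U (fun t => (Q * φ t).trace)) ∧
      (∀ (U : Set Times) (φ : Times → Matrix m n ℂ), IsPKPSolution (qMul Q) U φ →
        IsPKPSolution (fun a b : ℂ => a * b) U (fun t => (Q * φ t).trace))) ∧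
    -- the case `S = 0`, `Q = R K - K L`
    (∀ (L : Matrix m m ℂ) (R : Matrix n n ℂ) (Q K : Matrix n m ℂ)
      (X₀ : Matrix n n ℂ) (Y₀ φ₀ : Matrix m n ℂ) (H : Matrix (n ⊕ m) (n ⊕ m) ℂ)
      (Z₀ : Matrix (n ⊕ m) n ℂ) (φ : Times → Matrix m n ℂ) (τ : Times → ℂ),
      Q = R * K - K * L → H = Matrix.fromBlocks R Q 0 L → Z₀ = Matrix.fromRows X₀ Y₀ →
      IsUnit X₀ → φ₀ = Y₀ * X₀⁻¹ → φ = ratio (expSolution H Z₀) →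
      τ = (fun t => (tauMatrix R L K φ₀ t).det) →
        regularDomain H Z₀ = {t | t ∈ xiDomain R ∧ t ∈ xiDomain L ∧ τ t ≠ 0} ∧
        (0 : Times) ∈ regularDomain H Z₀ ∧
        IsPKPSolution (qMul Q) (regularDomain H Z₀) φ ∧
        (∀ t ∈ regularDomain H Z₀,
          φ t = NormedSpace.exp (xi L t) * φ₀ * (tauMatrix R L K φ₀ t)⁻¹
            * NormedSpace.exp (-xi R t) ∧
          HasLogPartialDeriv 1 τ ((Q * φ t).trace) t) ∧
        (Q.rank = 1 →
          IsPKPSolution (fun a b : ℂ => a * b) (regularDomain H Z₀)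
            (fun t => (Q * φ t).trace))) := by
  refine ⟨fun H U Z h hX => h.isRiccatiSolution hX,
    fun H Z₀ => ⟨isLinearSolution_expSolution H Z₀, isRiccatiSolution_expSolution H Z₀⟩,
    fun S L R Q U φ h => h.isPKPSolution,
    fun Q hQ => ⟨isLinearMap_trace_mul Q, trace_mul_qMul hQ, fun U φ hφ => hφ.trace_mul Q,
      fun U φ h => h.trace_mul hQ⟩, ?_⟩
  rintro L R _ K X₀ Y₀ _ _ _ _ _ rfl rfl rfl hX₀ rfl rfl rfl
  have hpkp := (isRiccatiSolution_expSolution (Matrix.fromBlocks R (R * K - K * L) 0 L)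
    (Matrix.fromRows X₀ Y₀)).isPKPSolution
  refine ⟨?_, zero_mem_regularDomain _ hX₀, hpkp, fun t ht => ⟨ratio_expSolution_eq hX₀ ht.1,
    hasLogPartialDeriv_det_tauMatrix hX₀ ht⟩, fun hQ => hpkp.trace_mul hQ⟩
  ext t
  constructor
  · intro ht
    have hRL := (xiDomain_blockTriangular L R K).subset ht.1
    exact ⟨hRL.1, hRL.2, (isUnit_toRows₁_expSolution_iff hX₀ ht.1).1 ht.2⟩
  · rintro ⟨h1, h2, h3⟩
    have h := (xiDomain_blockTriangular L R K).superset ⟨h1, h2⟩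
    exact ⟨h, (isUnit_toRows₁_expSolution_iff hX₀ h).2 h3⟩
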